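/- Let $\mathcal V$ be a Banach $\mathbb H$-space, i.e. a real Banach space that is both a left and a right vector space over the quaternions $\mathbb H$ (with the quaternionic multiplications extending the real one), such that all left and right multiplications $L_{\mathbf q},R_{\mathbf q}$, $\mathbf q\in\mathbb H$, are bounded and depend norm-continuously on $\mathbf q$. Let $\mathcal B^{\rm r}(\mathcal V)$ be the real Banach algebra of bounded operators $T$ on $\mathcal V$ with $T(x\mathbf q)=T(x)\mathbf q$ for all $x\in\mathcal V$, $\mathbf q\in\mathbb H$, and let $\mathcal B^{\rm r}(\mathcal V)_{\mathbb C}=\mathcal B^{\rm r}(\mathcal V)+i\mathcal B^{\rm r}(\mathcal V)$ be its complexification, a complex Banach algebra, with the conjugation $(A+iB)^\flat=A-iB$. For $T\in\mathcal B^{\rm r}(\mathcal V)$ put $$\sigma_{\mathbb C}(T)=\{\lambda\in\mathbb C:\ T^2-2(\Re\lambda)T+|\lambda|^2\ \text{is not invertible in}\ \mathcal B^{\rm r}(\mathcal V)\}.$$ For an open set $U\subset\mathbb C$ that is conjugate symmetric ($z\in U\Rightarrow\bar z\in U$), let $\mathcal O_s(U,\mathcal B^{\rm r}(\mathcal V)_{\mathbb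 C})$ be the real algebra of analytic functions $F:U\to\mathcal B^{\rm r}(\mathcal V)_{\mathbb C}$ with $F(\bar\zeta)=F(\zeta)^\flat$ for all $\zeta\in U$, and let $\mathcal O_s(U)$ be the real algebra of analytic functions $f:U\to\mathbb C$ with $f(\bar\zeta)=\overline{f(\zeta)}$ for all $\zeta\in U$. A Cauchy domain in $U$ is a bounded open set $\Delta$ with $\bar\Delta\subset U$ whose boundary $\Gamma$ consists of a finite family of piecewise smooth closed curves, positively oriented (of total index $1$ about each point of $\Delta$ and $0$ about each point outside $\bar\Delta$). Let $U\subset\mathbb C$ be open and conjugate symmetric, and let $T\in\mathcal B^{\rm r}(\mathcal V)$ with $\sigma_{\mathbb C}(T)\subset U$. Then there is a Cauchy domain $\Delta$ in $U$ containing $\sigma_{\mathbb C}(T)$, and for each $F\in\mathcal O_s(U,\mathcal B^{\rm r}(\mathcal V)_{\mathbb C})$ the element $$F(T)=\frac1{2\pi i}\int_\Gamma F(\zeta)(\zeta-T)^{-1}\,d\zeta$$ does not depend on the choice of such a $\Delta$ and belongs to $\mathcal B^{\rm r}(\mathcal V)$. The map $$\mathcal O_s(U,\mathcal B^{\rm r}(\mathcal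 V)_{\mathbb C})\ni F\mapsto F(T)\in\mathcal B^{\rm r}(\mathcal V)$$ is $\mathbb R$-linear, and the map $$\mathcal O_s(U)\ni f\mapsto f(T)\in\mathcal B^{\rm r}(\mathcal V)$$ (where $f$ is regarded as a $\mathcal B^{\rm r}(\mathcal V)_{\mathbb C}$-valued function) is a unital real algebra morphism. Moreover: (1) for all $F\in\mathcal O_s(U,\mathcal B^{\rm r}(\mathcal V)_{\mathbb C})$ and $f\in\mathcal O_s(U)$ we have $(Ff)(T)=F(T)f(T)$; (2) for every polynomial $P(\zeta)=\sum_{n=0}^m A_n\zeta^n$ with $A_n\in\mathcal B^{\rm r}(\mathcal V)$ for $n=0,\dots,m$, we have $P(T)=\sum_{n=0}^m A_nT^n\in\mathcal B^{\rm r}(\mathcal V)$. -/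

import Mathlib

open scoped Quaternion ComplexConjugate

noncomputable section

/-! ### The complexification of a real Banach algebra -/

/-- The complexification `A_ℂ = ℂ ⊗_ℝ A`, written as the direct sum `A + iA`. -/
@[ext]
structure Complexification (A : Type*) where
  /-- the component `a` of `a + ib` -/
  re : A
  /-- the component `b` of `a + ib` -/
  im : A

namespace Complexification

variable {A : Type*}

section Algebraic

variable [Ring A]

instance : Zero (Complexification A) := ⟨⟨0, 0⟩⟩
instance : One (Complexification A) := ⟨⟨1, 0⟩⟩
instance : Add (Complexification A) := ⟨fun x y => ⟨x.re + y.re, x.im + y.im⟩⟩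
instance : Neg (Complexification A) := ⟨fun x => ⟨-x.re, -x.im⟩⟩
instance : Sub (Complexification A) := ⟨fun x y => ⟨x.re - y.re, x.im - y.im⟩⟩
instance : Mul (Complexification A) :=
  ⟨fun x y => ⟨x.re * y.re - x.im * y.im, x.re * y.im + x.im * y.re⟩⟩

@[simp] theorem zero_re : (0 : Complexification A).re = 0 := rfl
@[simp] theorem zero_im : (0 : Complexification A).im = 0 := rfl
@[simp] theorem one_re : (1 : Complexification A).re = 1 := rfl
@[simp] theorem one_im : (1 : Complexification A).im = 0 := rfl
@[simp] theorem add_re (x y : Complexification A) : (x + y).re = x.re + y.re := rfl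
@[simp] theorem add_im (x y : Complexification A) : (x + y).im = x.im + y.im := rfl
@[simp] theorem neg_re (x : Complexification A) : (-x).re = -x.re := rfl
@[simp] theorem neg_im (x : Complexification A) : (-x).im = -x.im := rfl
@[simp] theorem sub_re (x y : Complexification A) : (x - y).re = x.re - y.re := rfl
@[simp] theorem sub_im (x y : Complexification A) : (x - y).im = x.im - y.im := rfl
@[simp] theorem mul_re (x y : Complexification A) :
    (x * y).re = x.re * y.re - x.im * y.im := rfl
@[simp] theorem mul_im (x y : Complexification A) :
    (x * y).im = x.re * y.im + x.im * y.re := rfl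

instance : Ring (Complexification A) where
  add_assoc x y z := by ext <;> simp [add_assoc]
  zero_add x := by ext <;> simp
  add_zero x := by ext <;> simp
  add_comm x y := by ext <;> simp [add_comm]
  neg_add_cancel x := by ext <;> simp
  sub_eq_add_neg x y := by ext <;> simp [sub_eq_add_neg]
  left_distrib x y z := by ext <;> simp <;> noncomm_ring
  right_distrib x y z := by ext <;> simp <;> noncomm_ring
  zero_mul x := by ext <;> simp
  mul_zero x := by ext <;> simp
  mul_assoc x y z := by ext <;> simp <;> noncomm_ring
  one_mul x := by ext <;> simp
  mul_one x := by ext <;> simp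
  nsmul := nsmulRec
  zsmul := zsmulRec

variable [Algebra ℝ A]

instance : SMul ℂ (Complexification A) :=
  ⟨fun z x => ⟨z.re • x.re - z.im • x.im, z.re • x.im + z.im • x.re⟩⟩

@[simp] theorem smul_re (z : ℂ) (x : Complexification A) :
    (z • x).re = z.re • x.re - z.im • x.im := rfl
@[simp] theorem smul_im (z : ℂ) (x : Complexification A) :
    (z • x).im = z.re • x.im + z.im • x.re := rfl

instance : Algebra ℂ (Complexification A) where
  algebraMap :=
    { toFun := fun z => ⟨z.re • 1, z.im • 1⟩
      map_zero' := by ext <;> simp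
      map_one' := by ext <;> simp
      map_add' := fun z w => by ext <;> simp [add_smul]
      map_mul' := fun z w => by
        ext
        · simp only [Complex.mul_re, mul_re, sub_smul, mul_smul, smul_mul_assoc, one_mul]
        · simp only [Complex.mul_im, mul_im, add_smul, mul_smul, smul_mul_assoc, one_mul] }
  commutes' z x := by ext <;> simp [add_comm]
  smul_def' z x := by ext <;> simp

end Algebraic

section Norm

variable [NormedRing A] [NormedAlgebra ℝ A]

/-- Left multiplication by `c = a + ib` on `A_ℂ`, where the real Banach space underlying `A_ℂ` is
realized as `ℂ →L[ℝ] A`: the element `x + iy` is the map `z ↦ (Re z) x - (Im z) y`, whose operator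
norm is `sup_θ ‖(cos θ) x - (sin θ) y‖`. -/
def leftMul (c : Complexification A) : (ℂ →L[ℝ] A) →L[ℝ] (ℂ →L[ℝ] A) :=
  ContinuousLinearMap.compL ℝ ℂ A A (ContinuousLinearMap.mul ℝ A c.re) +
    (ContinuousLinearMap.compL ℝ ℂ A A (ContinuousLinearMap.mul ℝ A c.im)).comp
      ((ContinuousLinearMap.compL ℝ ℂ ℂ A).flip (ContinuousLinearMap.mul ℝ ℂ Complex.I))

theorem leftMul_apply (c : Complexification A) (φ : ℂ →L[ℝ] A) (z : ℂ) :
    leftMul c φ z = c.re * φ z + c.im * φ (Complex.I * z) := rfl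

/-- The left regular representation of `A_ℂ`. -/
def leftMulHom : Complexification A →+* ((ℂ →L[ℝ] A) →L[ℝ] (ℂ →L[ℝ] A)) where
  toFun := leftMul
  map_zero' := by
    ext φ z
    simp [leftMul_apply]
  map_one' := by
    ext φ z
    simp [leftMul_apply]
  map_add' x y := by
    ext φ z
    simp only [leftMul_apply, add_apply, add_re, add_im]
    noncomm_ring
  map_mul' x y := by
    ext φ z
    simp only [leftMul_apply, mul_apply_eq_comp, mul_re, mul_im]
    rw [← mul_assoc Complex.I, Complex.I_mul_I, neg_one_mul, map_neg]
    noncomm_ring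

theorem leftMulHom_injective : Function.Injective (leftMulHom (A := A)) := by
  refine (injective_iff_map_eq_zero (leftMulHom (A := A)).toAddMonoidHom).2 fun c hc => ?_
  have h : ∀ (φ : ℂ →L[ℝ] A) (z : ℂ), c.re * φ z + c.im * φ (Complex.I * z) = 0 := by
    intro φ z
    rw [← leftMul_apply]
    exact DFunLike.congr_fun (DFunLike.congr_fun hc φ) z
  have h1 := h (Complex.reCLM.smulRight (1 : A)) 1
  have h2 := h (Complex.reCLM.smulRight (1 : A)) Complex.I
  ext
  · simpa using h1
  · simpa using h2

/-- The norm of `A_ℂ` is the operator norm of the left regular representation. It is a complex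
algebra norm and defines the product topology of `A + iA`; see `norm_le` and `norm_re_le`,
`norm_im_le` below. -/
instance : NormedRing (Complexification A) :=
  NormedRing.induced (Complexification A) ((ℂ →L[ℝ] A) →L[ℝ] (ℂ →L[ℝ] A))
    leftMulHom leftMulHom_injective

theorem norm_def (c : Complexification A) : ‖c‖ = ‖leftMul c‖ := rfl

instance : NormedAlgebra ℂ (Complexification A) where
  norm_smul_le w c := by
    rw [norm_def, norm_def]
    refine ContinuousLinearMap.opNorm_le_bound _ (by positivity) fun φ => ?_
    have h : leftMul (w • c) φ = (leftMul c φ).comp (ContinuousLinearMap.mul ℝ ℂ w) := by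
      ext z
      have key : ∀ v : ℂ, φ (w * v) = w.re • φ v + w.im • φ (Complex.I * v) := by
        intro v
        rw [← map_smul, ← map_smul, ← map_add]
        congr 1
        apply Complex.ext
        · simp
          ring
        · simp
      have key2 : φ (Complex.I * (w * z)) = w.re • φ (Complex.I * z) - w.im • φ z := by
        rw [mul_left_comm, key, ← mul_assoc, Complex.I_mul_I, neg_one_mul, map_neg, smul_neg,
          sub_eq_add_neg]
      simp only [leftMul_apply, ContinuousLinearMap.comp_apply, ContinuousLinearMap.mul_apply',
        smul_re, smul_im, key z, key2, sub_mul, add_mul, mul_add, mul_sub, smul_mul_assoc,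
        mul_smul_comm]
      abel
    rw [h]
    calc ‖(leftMul c φ).comp (ContinuousLinearMap.mul ℝ ℂ w)‖
        ≤ ‖leftMul c φ‖ * ‖ContinuousLinearMap.mul ℝ ℂ w‖ := ContinuousLinearMap.opNorm_comp_le _ _
      _ ≤ (‖leftMul c‖ * ‖φ‖) * ‖w‖ := by
          gcongr
          · exact ContinuousLinearMap.le_opNorm _ _
          · exact ContinuousLinearMap.opNorm_mul_apply_le ℝ ℂ w
      _ = ‖w‖ * ‖leftMul c‖ * ‖φ‖ := by ring

theorem norm_le (c : Complexification A) : ‖c‖ ≤ ‖c.re‖ + ‖c.im‖ := by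
  rw [norm_def]
  refine ContinuousLinearMap.opNorm_le_bound _ (by positivity) fun φ => ?_
  refine ContinuousLinearMap.opNorm_le_bound _ (by positivity) fun z => ?_
  rw [leftMul_apply]
  calc ‖c.re * φ z + c.im * φ (Complex.I * z)‖
      ≤ ‖c.re‖ * ‖φ z‖ + ‖c.im‖ * ‖φ (Complex.I * z)‖ :=
        (norm_add_le _ _).trans (add_le_add (norm_mul_le _ _) (norm_mul_le _ _))
    _ ≤ ‖c.re‖ * (‖φ‖ * ‖z‖) + ‖c.im‖ * (‖φ‖ * ‖z‖) := by
        gcongr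
        · exact φ.le_opNorm z
        · simpa using φ.le_opNorm (Complex.I * z)
    _ = (‖c.re‖ + ‖c.im‖) * ‖φ‖ * ‖z‖ := by ring

theorem norm_re_le (c : Complexification A) : ‖c.re‖ ≤ ‖(1 : A)‖ * ‖c‖ := by
  have h := (leftMul c (Complex.reCLM.smulRight (1 : A))).le_opNorm 1
  have h' := (leftMul c).le_opNorm (Complex.reCLM.smulRight (1 : A))
  rw [leftMul_apply] at h
  simp only [ContinuousLinearMap.norm_smulRight_apply, Complex.reCLM_norm, one_mul] at h'
  simp at h
  rw [norm_def]
  linarith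

theorem norm_im_le (c : Complexification A) : ‖c.im‖ ≤ ‖(1 : A)‖ * ‖c‖ := by
  have h := (leftMul c (Complex.reCLM.smulRight (1 : A))).le_opNorm Complex.I
  have h' := (leftMul c).le_opNorm (Complex.reCLM.smulRight (1 : A))
  rw [leftMul_apply] at h
  simp only [ContinuousLinearMap.norm_smulRight_apply, Complex.reCLM_norm, one_mul] at h'
  simp at h
  rw [norm_def]
  linarith

theorem real_smul_re (r : ℝ) (c : Complexification A) : (r • c).re = r • c.re := by
  change ((r : ℂ) • c).re = _
  rw [smul_re, Complex.ofReal_re, Complex.ofReal_im, zero_smul, sub_zero]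

theorem real_smul_im (r : ℝ) (c : Complexification A) : (r • c).im = r • c.im := by
  change ((r : ℂ) • c).im = _
  rw [smul_im, Complex.ofReal_re, Complex.ofReal_im, zero_smul, add_zero]

/-- The embedding `a ↦ a + i0` of `A` into `A_ℂ`. -/
def of : A →ₐ[ℝ] Complexification A :=
  AlgHom.ofLinearMap
    { toFun := fun a => ⟨a, 0⟩
      map_add' := fun a b => by ext <;> simp
      map_smul' := fun r a => by ext <;> simp [real_smul_re, real_smul_im] }
    rfl (fun a b => by ext <;> simp)

/-- The conjugation `a + ib ↦ a - ib` of `A_ℂ`. -/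
def conjugation : Complexification A →ₐ[ℝ] Complexification A :=
  AlgHom.ofLinearMap
    { toFun := fun c => ⟨c.re, -c.im⟩
      map_add' := fun x y => by ext <;> simp [add_comm]
      map_smul' := fun r x => by ext <;> simp [real_smul_re, real_smul_im] }
    (by ext <;> simp) (fun x y => by ext <;> simp [add_comm])

@[simp] theorem of_re (a : A) : (of a).re = a := rfl
@[simp] theorem of_im (a : A) : (of a).im = 0 := rfl
@[simp] theorem conjugation_re (c : Complexification A) : (conjugation c).re = c.re := rfl
@[simp] theorem conjugation_im (c : Complexification A) : (conjugation c).im = -c.im := rfl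

theorem conjugation_smul (z : ℂ) (c : Complexification A) :
    conjugation (z • c) = (starRingEnd ℂ z) • conjugation c := by
  ext <;> simp [add_comm]

theorem conjugation_of (a : A) : conjugation (of a) = of a := by
  ext <;> simp

end Norm

end Complexification

/-! ### Spectrum -/

/-- The complex spectrum `σ_ℂ(a)` of an element of a real algebra. -/
def complexSpectrum {A : Type*} [Ring A] [Algebra ℝ A] (a : A) : Set ℂ :=
  {l : ℂ | ¬ IsUnit (a ^ 2 - (2 * l.re) • a + algebraMap ℝ A (‖l‖ ^ 2))}

/-! ### Right quaternionic linear operators -/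

/-- The real algebra `B^r(V)` of the bounded real linear operators on `V` that are right
`ℍ`-linear; the right multiplication `x q` is `MulOpposite.op q • x`. -/
def rightLinearOperators (V : Type*) [NormedAddCommGroup V] [NormedSpace ℝ V]
    [Module ℍ[ℝ]ᵐᵒᵖ V] [IsScalarTower ℝ ℍ[ℝ]ᵐᵒᵖ V] : Subalgebra ℝ (V →L[ℝ] V) where
  carrier := {T | ∀ (q : ℍ[ℝ]) (x : V),
    T (MulOpposite.op q • x) = MulOpposite.op q • T x}
  mul_mem' {S T} hS hT q x := by
    simp only [mul_apply_eq_comp]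
    rw [hT, hS]
  add_mem' {S T} hS hT q x := by
    simp only [add_apply]
    rw [hT, hS, smul_add]
  algebraMap_mem' r q x := by
    have : SMulCommClass ℝ ℍ[ℝ]ᵐᵒᵖ V := IsScalarTower.to_smulCommClass
    simp only [Algebra.algebraMap_eq_smul_one, smul_apply,
      one_apply_eq_self]
    exact smul_comm r (MulOpposite.op q) x

/-! ### Stem functions -/

/-- Extension by zero of a function on `U` to the whole plane. -/
def zeroExtend {U : Set ℂ} {B : Type*} [Zero B] (F : U → B) : ℂ → B :=
  open Classical in fun z => if h : z ∈ U then F ⟨z, h⟩ else 0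

theorem zeroExtend_apply {U : Set ℂ} {B : Type*} [Zero B] (F : U → B) {z : ℂ} (h : z ∈ U) :
    zeroExtend F z = F ⟨z, h⟩ := by
  simp [zeroExtend, h]

/-- The functions `F : U → B`, analytic on `U`, with `F (z̄) = c (F z)` whenever `z, z̄ ∈ U`, where
`c` is a conjugation of the complex algebra `B`; a real algebra under the pointwise operations. -/
def stemFunctionsWith (U : Set ℂ) {B : Type*} [NormedRing B] [NormedAlgebra ℂ B]
    (c : B →ₐ[ℝ] B) : Subalgebra ℝ (U → B) where
  carrier := {F | DifferentiableOn ℂ (zeroExtend F) U ∧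
    ∀ z w : U, (w : ℂ) = conj (z : ℂ) → F w = c (F z)}
  mul_mem' {F G} hF hG := by
    refine ⟨(hF.1.mul hG.1).congr fun z hz => ?_, fun z w h => ?_⟩
    · simp [zeroExtend_apply _ hz]
    · simp [hF.2 z w h, hG.2 z w h]
  add_mem' {F G} hF hG := by
    refine ⟨(hF.1.add hG.1).congr fun z hz => ?_, fun z w h => ?_⟩
    · simp [zeroExtend_apply _ hz]
    · simp [hF.2 z w h, hG.2 z w h]
  algebraMap_mem' r := by
    refine ⟨(differentiableOn_const (algebraMap ℝ B r)).congr fun z hz => ?_, fun z w h => ?_⟩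
    · simp [zeroExtend_apply _ hz]
    · simp

/-- `O_s(U, A_ℂ)`. -/
abbrev StemFunctions (U : Set ℂ) (A : Type*) [NormedRing A] [NormedAlgebra ℝ A] :
    Subalgebra ℝ (U → Complexification A) :=
  stemFunctionsWith U Complexification.conjugation

/-- `O_s(U) = O_s(U, ℂ)`. -/
abbrev ScalarStemFunctions (U : Set ℂ) : Subalgebra ℝ (U → ℂ) :=
  stemFunctionsWith U (Complex.conjAe : ℂ →ₐ[ℝ] ℂ)

/-- The product `F f`, where `F ∈ O_s(U, A_ℂ)` and `f ∈ O_s(U)`. -/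
def StemFunctions.mulScalar {U : Set ℂ} {A : Type*} [NormedRing A] [NormedAlgebra ℝ A]
    (F : StemFunctions U A) (f : ScalarStemFunctions U) : StemFunctions U A :=
  ⟨fun z => F.1 z * algebraMap ℂ (Complexification A) (f.1 z), by
    refine ⟨(F.2.1.mul
      (f.2.1.smul_const (1 : Complexification A))).congr fun z hz => ?_, fun z w h => ?_⟩
    · simp [zeroExtend_apply _ hz, Algebra.algebraMap_eq_smul_one]
    · simp [F.2.2 z w h, f.2.2 z w h, Algebra.algebraMap_eq_smul_one, Complexification.conjugation_smul]⟩

/-- The polynomial `P(z) = ∑_{n ≤ m} a_n z^n` with coefficients in `A`, as an element of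
`O_s(U, A_ℂ)`. -/
def StemFunctions.polynomial (U : Set ℂ) {A : Type*} [NormedRing A] [NormedAlgebra ℝ A]
    (m : ℕ) (a : ℕ → A) : StemFunctions U A :=
  ⟨fun z => ∑ n ∈ Finset.range (m + 1), ((z : ℂ) ^ n) • Complexification.of (a n), by
    have hd : DifferentiableOn ℂ (fun z : ℂ => ∑ n ∈ Finset.range (m + 1),
        (z ^ n) • Complexification.of (a n)) U := by
      fun_prop
    refine ⟨hd.congr fun z hz => ?_, fun z w h => ?_⟩
    · simp [zeroExtend_apply _ hz]
    · simp [h, Complexification.conjugation_smul, Complexification.conjugation_of]⟩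

/-! ### Cauchy domains and contour integrals -/

/-- `γ`, restricted to `[0, 1]`, is a piecewise continuously differentiable curve. -/
def IsPiecewiseC1 (γ : ℝ → ℂ) : Prop :=
  ∃ (n : ℕ) (t : ℕ → ℝ), Monotone t ∧ t 0 = 0 ∧ t n = 1 ∧
    ∀ i < n, ContDiffOn ℝ 1 γ (Set.Icc (t i) (t (i + 1)))

/-- `∫_γ g(ζ) dζ` for a curve parametrized by `[0, 1]`. -/
def contourIntegral {B : Type*} [NormedAddCommGroup B] [NormedSpace ℂ B]
    (γ : ℝ → ℂ) (g : ℂ → B) : B :=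
  ∫ t in (0 : ℝ)..1, deriv γ t • g (γ t)

/-- A Cauchy domain in `U`: a bounded open set whose closure lies in `U` and whose boundary
consists of a finite family of piecewise smooth closed curves that is positively oriented, i.e. of
total index one about the points of the domain and of total index zero about the points outside
its closure. -/
structure CauchyDomain (U : Set ℂ) where
  /-- the domain -/
  carrier : Set ℂ
  isOpen : IsOpen carrier
  isBounded : Bornology.IsBounded carrier
  closure_subset : closure carrier ⊆ U
  /-- the number of boundary curves -/
  n : ℕ
  /-- the boundary curves, parametrized by `[0, 1]` -/
  curve : Fin n → ℝ → ℂ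
  piecewiseC1 : ∀ j, IsPiecewiseC1 (curve j)
  closed : ∀ j, curve j 0 = curve j 1
  frontier_eq : frontier carrier = ⋃ j, curve j '' Set.Icc 0 1
  index_eq_one : ∀ z ∈ carrier,
    (2 * Real.pi * Complex.I)⁻¹ * ∑ j, contourIntegral (curve j) (fun ζ => (ζ - z)⁻¹) = 1
  index_eq_zero : ∀ z ∉ closure carrier,
    (2 * Real.pi * Complex.I)⁻¹ * ∑ j, contourIntegral (curve j) (fun ζ => (ζ - z)⁻¹) = 0

/-- The Riesz-Dunford integral `(2πi)⁻¹ ∫_Γ F(ζ) (ζ - T)⁻¹ dζ ∈ A_ℂ` over the boundary `Γ` of the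
Cauchy domain `Δ`; `resolvent T ζ` is the inverse of `ζ - T` in `A_ℂ`. -/
def rieszDunford {U : Set ℂ} {A : Type*} [NormedRing A] [NormedAlgebra ℝ A]
    (Δ : CauchyDomain U) (F : U → Complexification A) (T : A) : Complexification A :=
  (2 * Real.pi * Complex.I : ℂ)⁻¹ • ∑ j, contourIntegral (Δ.curve j)
    (fun ζ => zeroExtend F ζ * resolvent (Complexification.of T) ζ)

/-- The function `f ∈ O_s(U)`, regarded as an `A_ℂ`-valued function. -/
def StemFunctions.ofScalar {U : Set ℂ} (A : Type*) [NormedRing A] [NormedAlgebra ℝ A]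
    (f : ScalarStemFunctions U) : StemFunctions U A :=
  StemFunctions.mulScalar 1 f

end

noncomputable section

open Set MeasureTheory Topology Filter

/-! ### Piecewise continuously differentiable curves -/

section Curves

variable {B : Type*} [NormedAddCommGroup B] [NormedSpace ℂ B] {γ γ₁ γ₂ : ℝ → ℂ}

/-! Write `A` for the real Banach algebra of right linear operators; it is complete because it is
closed in the bounded operators. Everything takes place in the complex Banach algebra `A_ℂ`, by the
classical Riesz-Dunford calculus. The factorization `(z - T)(z̄ - T) = T² - 2 (Re z) T + |z|²`
(`algebraMap_sub_of_mul`), whose factors commute and are exchanged by conjugation, identifies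
`σ_ℂ(T)` with the spectrum of `T` in `A_ℂ` (`spectrum_of`); in particular it is compact.

Since the boundary curves of a Cauchy domain are arbitrary, the homological form of Cauchy's theorem
is needed. It rests on polygonal domains: around a compact set, take all squares of a fine lattice
that meet it and keep the edges that do not cancel (`exists_cauchyDomain`). For such a boundary,
Cauchy's theorem reduces to rectangles, and Cauchy's formula follows by integrating the difference
quotient. Inserting this formula into the integral of `f` over a family of curves and using Fubini
turns it into an integral of `f` times the index of the family over the polygonal boundary. Families
with equal index off the compact set therefore have equal integrals
(`sum_contourIntegral_eq_of_index_eq`), and the calculus does not depend on the domain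
(`dunford_eq`).

Multiplicativity is the double integral over two nested boundaries, split by the resolvent identity
(`dunford_mul_algebraMap_of_closure_subset`). The value at `1` comes from a large circle
(`dunford_one`), and polynomials follow by pulling constants out on the left. Finally, `F(T)` is
real: conjugating the integral gives the integral of the same stem function over the mirrored
domain, hence the same element (`conjugation_dunford`), and the fixed points of the conjugation are
`A`. -/

theorem IsPiecewiseC1.continuousOn (hγ : IsPiecewiseC1 γ) : ContinuousOn γ (Icc 0 1) := by
  obtain ⟨n, t, ht, h0, h1, hc⟩ := hγ
  have key : ∀ k ≤ n, ContinuousOn γ (Icc (t 0) (t k)) := by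
    intro k
    induction k with
    | zero => intro _; simp
    | succ k ih =>
      intro hk
      rw [← Icc_union_Icc_eq_Icc (ht (Nat.zero_le k)) (ht (Nat.le_succ k))]
      exact (ih (by omega)).union_of_isClosed (hc k (by omega)).continuousOn isClosed_Icc
        isClosed_Icc
  have := key n le_rfl
  rwa [h0, h1] at this

/-- On the interior of each piece `deriv γ` is the derivative within the closed piece, which is
continuous. Its values at the breakpoints are irrelevant to the integral. -/
theorem IsPiecewiseC1.intervalIntegrable_deriv (hγ : IsPiecewiseC1 γ) :
    IntervalIntegrable (deriv γ) volume 0 1 := by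
  obtain ⟨n, t, ht, h0, h1, hc⟩ := hγ
  rw [← h0, ← h1]
  refine IntervalIntegrable.trans_iterate fun k hk => ?_
  -- The partition is only monotone, so a piece may be a single point.
  rcases (ht (Nat.le_succ k)).eq_or_lt with h | h
  · rw [← Nat.succ_eq_add_one, ← h]
  · have hd : ContinuousOn (derivWithin γ (Icc (t k) (t (k + 1)))) (uIcc (t k) (t (k + 1))) := by
      rw [uIcc_of_le h.le]
      exact (hc k hk).continuousOn_derivWithin (uniqueDiffOn_Icc h) le_rfl
    refine hd.intervalIntegrable.congr_uIoo fun x hx => ?_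
    rw [uIoo_of_le h.le] at hx
    exact derivWithin_of_mem_nhds (Icc_mem_nhds hx.1 hx.2)

theorem IsPiecewiseC1.intervalIntegrable (hγ : IsPiecewiseC1 γ) {g : ℂ → B}
    (hg : ContinuousOn g (γ '' Icc 0 1)) :
    IntervalIntegrable (fun t => deriv γ t • g (γ t)) volume 0 1 := by
  refine hγ.intervalIntegrable_deriv.smul_continuousOn ?_
  rw [uIcc_of_le zero_le_one]
  exact hg.comp hγ.continuousOn (mapsTo_image _ _)

theorem IsPiecewiseC1.isCompact_image (hγ : IsPiecewiseC1 γ) : IsCompact (γ '' Icc 0 1) :=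
  isCompact_Icc.image_of_continuousOn hγ.continuousOn

theorem contourIntegral_congr {g g' : ℂ → B} (h : EqOn g g' (γ '' Icc 0 1)) :
    contourIntegral γ g = contourIntegral γ g' := by
  refine intervalIntegral.integral_congr fun t ht => ?_
  rw [uIcc_of_le zero_le_one] at ht
  simp only [h (mem_image_of_mem γ ht)]

theorem contourIntegral_add (hγ : IsPiecewiseC1 γ) {g g' : ℂ → B}
    (hg : ContinuousOn g (γ '' Icc 0 1)) (hg' : ContinuousOn g' (γ '' Icc 0 1)) :
    contourIntegral γ (fun z => g z + g' z) = contourIntegral γ g + contourIntegral γ g' := by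
  simp only [contourIntegral, smul_add]
  exact intervalIntegral.integral_add (hγ.intervalIntegrable hg) (hγ.intervalIntegrable hg')

theorem contourIntegral_sub (hγ : IsPiecewiseC1 γ) {g g' : ℂ → B}
    (hg : ContinuousOn g (γ '' Icc 0 1)) (hg' : ContinuousOn g' (γ '' Icc 0 1)) :
    contourIntegral γ (fun z => g z - g' z) = contourIntegral γ g - contourIntegral γ g' := by
  simp only [contourIntegral, smul_sub]
  exact intervalIntegral.integral_sub (hγ.intervalIntegrable hg) (hγ.intervalIntegrable hg')

theorem contourIntegral_smul (c : ℂ) (g : ℂ → B) :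
    contourIntegral γ (fun z => c • g z) = c • contourIntegral γ g := by
  simp only [contourIntegral, smul_comm _ c]
  exact intervalIntegral.integral_smul c _

theorem contourIntegral_sum {ι : Type*} (s : Finset ι) (hγ : IsPiecewiseC1 γ) {g : ι → ℂ → B}
    (hg : ∀ i ∈ s, ContinuousOn (g i) (γ '' Icc 0 1)) :
    contourIntegral γ (fun z => ∑ i ∈ s, g i z) = ∑ i ∈ s, contourIntegral γ (g i) := by
  simp only [contourIntegral, Finset.smul_sum]
  exact intervalIntegral.integral_finsetSum fun i hi => hγ.intervalIntegrable (hg i hi)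

theorem contourIntegral_smul_const [CompleteSpace B] (g : ℂ → ℂ) (b : B) :
    contourIntegral γ (fun z => g z • b) = contourIntegral γ g • b := by
  simp only [contourIntegral, ← smul_assoc]
  exact intervalIntegral.integral_smul_const _ b

theorem ContinuousLinearMap.contourIntegral_comp [CompleteSpace B] {B' : Type*}
    [NormedAddCommGroup B'] [NormedSpace ℂ B'] [CompleteSpace B'] (l : B →L[ℂ] B')
    (hγ : IsPiecewiseC1 γ) {g : ℂ → B} (hg : ContinuousOn g (γ '' Icc 0 1)) :
    contourIntegral γ (fun z => l (g z)) = l (contourIntegral γ g) := by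
  simp only [contourIntegral, ← map_smul]
  exact l.intervalIntegral_comp_comm (hγ.intervalIntegrable hg)

/-- Fubini's theorem for iterated contour integrals. -/
theorem contourIntegral_swap (h₁ : IsPiecewiseC1 γ₁) (h₂ : IsPiecewiseC1 γ₂) {G : ℂ → ℂ → B}
    (hG : ContinuousOn (Function.uncurry G) ((γ₁ '' Icc 0 1) ×ˢ (γ₂ '' Icc 0 1))) :
    contourIntegral γ₁ (fun z => contourIntegral γ₂ (G z)) =
      contourIntegral γ₂ (fun w => contourIntegral γ₁ (fun z => G z w)) := by
  simp only [contourIntegral, ← intervalIntegral.integral_smul]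
  simp only [intervalIntegral.integral_of_le zero_le_one]
  have hd : Integrable (fun p : ℝ × ℝ => deriv γ₁ p.1 * deriv γ₂ p.2)
      ((volume.restrict (Ioc 0 1)).prod (volume.restrict (Ioc 0 1))) :=
    ((intervalIntegrable_iff_integrableOn_Ioc_of_le zero_le_one).1
      h₁.intervalIntegrable_deriv).mul_prod
      ((intervalIntegrable_iff_integrableOn_Ioc_of_le zero_le_one).1 h₂.intervalIntegrable_deriv)
  have hc : ContinuousOn (fun p : ℝ × ℝ => G (γ₁ p.1) (γ₂ p.2)) (Icc 0 1 ×ˢ Icc 0 1) := by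
    have : ContinuousOn (fun p : ℝ × ℝ => (γ₁ p.1, γ₂ p.2)) (Icc 0 1 ×ˢ Icc 0 1) :=
      h₁.continuousOn.prodMap h₂.continuousOn
    exact hG.comp this fun p hp => ⟨mem_image_of_mem _ hp.1, mem_image_of_mem _ hp.2⟩
  rw [Measure.prod_restrict] at hd
  have hi : IntegrableOn (fun p : ℝ × ℝ => (deriv γ₁ p.1 * deriv γ₂ p.2) • G (γ₁ p.1) (γ₂ p.2))
      (Ioc 0 1 ×ˢ Ioc 0 1) (volume.prod volume) :=
    IntegrableOn.smul_continuousOn_of_subset hd hc (measurableSet_Ioc.prod measurableSet_Ioc)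
      (isCompact_Icc.prod isCompact_Icc) (prod_mono Ioc_subset_Icc_self Ioc_subset_Icc_self)
  rw [IntegrableOn, ← Measure.prod_restrict] at hi
  have := integral_integral_swap
    (f := fun s t => (deriv γ₁ s * deriv γ₂ t) • G (γ₁ s) (γ₂ t)) hi
  simp only [mul_smul] at this
  rw [this]
  exact integral_congr_ae (.of_forall fun w => integral_congr_ae (.of_forall fun z =>
    smul_comm _ _ _))

/-- Dominated convergence: `G` is bounded by some `C` on the compact product, so `‖γ'‖ C` is an
integrable bound. This continuity lets finite sums pass through the outer integral of an iterated
one. -/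
theorem continuousOn_contourIntegral (hγ : IsPiecewiseC1 γ) {K : Set ℂ} (hK : IsCompact K)
    {G : ℂ → ℂ → B} (hG : ContinuousOn (Function.uncurry G) (K ×ˢ (γ '' Icc 0 1))) :
    ContinuousOn (fun z => contourIntegral γ (G z)) K := by
  obtain ⟨C, hC⟩ := (hK.prod hγ.isCompact_image).exists_bound_of_continuousOn hG
  intro z hz
  refine intervalIntegral.continuousWithinAt_of_dominated_interval
    (bound := fun t => ‖deriv γ t‖ * C) ?_ ?_ ?_ ?_
  · filter_upwards [self_mem_nhdsWithin] with z' hz'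
    refine (hγ.intervalIntegrable ?_).aestronglyMeasurable_restrict_uIoc
    exact hG.comp (f := fun w => (z', w)) (by fun_prop) fun w hw => ⟨hz', hw⟩
  · filter_upwards [self_mem_nhdsWithin] with z' hz'
    refine Eventually.of_forall fun t ht => ?_
    rw [uIoc_of_le zero_le_one] at ht
    rw [norm_smul]
    gcongr
    exact hC (z', γ t) ⟨hz', mem_image_of_mem γ (Ioc_subset_Icc_self ht)⟩
  · exact hγ.intervalIntegrable_deriv.norm.mul_const _
  · refine Eventually.of_forall fun t ht => ?_
    rw [uIoc_of_le zero_le_one] at ht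
    have hc : ContinuousOn (fun x => G x (γ t)) K :=
      hG.comp (f := fun x => (x, γ t)) (by fun_prop) fun w hw =>
        ⟨hw, mem_image_of_mem γ (Ioc_subset_Icc_self ht)⟩
    exact (hc z hz).const_smul (deriv γ t)

theorem sum_contourIntegral_swap {ι ι' : Type*} [Fintype ι] [Fintype ι'] {γ : ι → ℝ → ℂ}
    {γ' : ι' → ℝ → ℂ} {K K' : Set ℂ} (hK : IsCompact K) (hK' : IsCompact K')
    (hγ : ∀ i, IsPiecewiseC1 (γ i)) (hγ' : ∀ j, IsPiecewiseC1 (γ' j))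
    (hγK : ∀ i, γ i '' Icc 0 1 ⊆ K) (hγL : ∀ j, γ' j '' Icc 0 1 ⊆ K') {G : ℂ → ℂ → B}
    (hG : ContinuousOn (Function.uncurry G) (K ×ˢ K')) :
    ∑ i, contourIntegral (γ i) (fun z => ∑ j, contourIntegral (γ' j) (G z)) =
      ∑ j, contourIntegral (γ' j) (fun w => ∑ i, contourIntegral (γ i) (fun z => G z w)) := by
  have hG' : ContinuousOn (Function.uncurry fun w z => G z w) (K' ×ˢ K) :=
    hG.comp continuous_swap.continuousOn fun p hp => ⟨hp.2, hp.1⟩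
  have e₁ : ∀ i, contourIntegral (γ i) (fun z => ∑ j, contourIntegral (γ' j) (G z)) =
      ∑ j, contourIntegral (γ i) (fun z => contourIntegral (γ' j) (G z)) := fun i =>
    contourIntegral_sum _ (hγ i) fun j _ => (continuousOn_contourIntegral (hγ' j) hK
      (hG.mono (prod_mono_right (hγL j)))).mono (hγK i)
  have e₂ : ∀ j, contourIntegral (γ' j) (fun w => ∑ i, contourIntegral (γ i) (fun z => G z w)) =
      ∑ i, contourIntegral (γ' j) (fun w => contourIntegral (γ i) (fun z => G z w)) := fun j =>
    contourIntegral_sum _ (hγ' j) fun i _ => (continuousOn_contourIntegral (hγ i) hK'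
      (hG'.mono (prod_mono_right (hγK i)))).mono (hγL j)
  simp only [e₁, e₂]
  rw [Finset.sum_comm]
  exact Finset.sum_congr rfl fun j _ => Finset.sum_congr rfl fun i _ =>
    contourIntegral_swap (hγ i) (hγ' j) (hG.mono (prod_mono (hγK i) (hγL j)))

/-- The Cauchy transform of a curve is continuous off the curve. -/
theorem continuousAt_contourIntegral_sub_inv (hγ : IsPiecewiseC1 γ) {z : ℂ}
    (hz : z ∉ γ '' Icc 0 1) :
    ContinuousAt (fun z => contourIntegral γ (fun w => (w - z)⁻¹)) z := by
  obtain ⟨δ, hδ, hball⟩ := Metric.isOpen_iff.1 hγ.isCompact_image.isClosed.isOpen_compl z hz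
  have hfar : ∀ z' ∈ Metric.ball z (δ / 2), ∀ t ∈ Icc (0 : ℝ) 1, δ / 2 ≤ ‖γ t - z'‖ := by
    intro z' hz' t ht
    have h1 : δ ≤ dist (γ t) z := by
      by_contra! h
      exact hball h (mem_image_of_mem γ ht)
    have h2 := dist_triangle (γ t) z' z
    rw [Metric.mem_ball] at hz'
    rw [← dist_eq_norm]
    linarith
  have hnhds : Metric.ball z (δ / 2) ∈ 𝓝 z := Metric.ball_mem_nhds z (by positivity)
  refine intervalIntegral.continuousAt_of_dominated_interval
    (bound := fun t => ‖deriv γ t‖ * (δ / 2)⁻¹) ?_ ?_ ?_ ?_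
  · filter_upwards [hnhds] with z' hz'
    refine (hγ.intervalIntegrable (g := fun w => (w - z')⁻¹) ?_).aestronglyMeasurable_restrict_uIoc
    refine ContinuousOn.inv₀ (by fun_prop) ?_
    rintro _ ⟨t, ht, rfl⟩ h0
    have := hfar z' hz' t ht
    rw [h0, norm_zero] at this
    linarith
  · filter_upwards [hnhds] with z' hz'
    refine Eventually.of_forall fun t ht => ?_
    rw [uIoc_of_le zero_le_one] at ht
    rw [norm_smul, norm_inv]
    gcongr
    exact hfar z' hz' t (Ioc_subset_Icc_self ht)
  · exact hγ.intervalIntegrable_deriv.norm.mul_const _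
  · refine Eventually.of_forall fun t ht => ?_
    rw [uIoc_of_le zero_le_one] at ht
    have h0 : γ t - z ≠ 0 := by
      intro h0
      have := hfar z (Metric.mem_ball_self (by positivity)) t (Ioc_subset_Icc_self ht)
      rw [h0, norm_zero] at this
      linarith
    have hc : ContinuousAt (fun x => (γ t - x)⁻¹) z :=
      ContinuousAt.inv₀ (by fun_prop) h0
    exact hc.const_smul (deriv γ t)

end Curves

/-! ### Concatenation -/

section Concatenation

variable {B : Type*} [NormedAddCommGroup B] [NormedSpace ℂ B] {γ₁ γ₂ : ℝ → ℂ}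

/-- The concatenation of two curves parametrized by `[0, 1]`. -/
def concatCurve (γ₁ γ₂ : ℝ → ℂ) : ℝ → ℂ := fun t =>
  if t ≤ 1 / 2 then γ₁ (2 * t) else γ₂ (2 * t - 1)

theorem concatCurve_zero : concatCurve γ₁ γ₂ 0 = γ₁ 0 := by simp [concatCurve]

theorem concatCurve_one : concatCurve γ₁ γ₂ 1 = γ₂ 1 := by
  norm_num [concatCurve]

theorem concatCurve_eqOn_left : EqOn (concatCurve γ₁ γ₂) (fun t => γ₁ (2 * t)) (Iic (1 / 2)) :=
  fun _ ht => if_pos ht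

theorem concatCurve_eqOn_right (h : γ₁ 1 = γ₂ 0) :
    EqOn (concatCurve γ₁ γ₂) (fun t => γ₂ (2 * t - 1)) (Ici (1 / 2)) := by
  intro t ht
  rcases (mem_Ici.1 ht).eq_or_lt with rfl | ht
  · norm_num [concatCurve, h]
  · exact if_neg (not_le.2 ht)

theorem image_concatCurve (h : γ₁ 1 = γ₂ 0) :
    concatCurve γ₁ γ₂ '' Icc 0 1 = γ₁ '' Icc 0 1 ∪ γ₂ '' Icc 0 1 := by
  rw [← Icc_union_Icc_eq_Icc (b := (1 / 2 : ℝ)) (by norm_num) (by norm_num), image_union,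
    image_congr (concatCurve_eqOn_left.mono Icc_subset_Iic_self),
    image_congr ((concatCurve_eqOn_right h).mono Icc_subset_Ici_self),
    Icc_union_Icc_eq_Icc (by norm_num) (by norm_num)]
  congr 1
  · ext z
    constructor
    · rintro ⟨t, ht, rfl⟩
      exact ⟨2 * t, ⟨by linarith [ht.1], by linarith [ht.2]⟩, rfl⟩
    · rintro ⟨t, ht, rfl⟩
      exact ⟨t / 2, ⟨by linarith [ht.1], by linarith [ht.2]⟩, by ring_nf⟩
  · ext z
    constructor
    · rintro ⟨t, ht, rfl⟩
      exact ⟨2 * t - 1, ⟨by linarith [ht.1], by linarith [ht.2]⟩, rfl⟩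
    · rintro ⟨t, ht, rfl⟩
      exact ⟨(t + 1) / 2, ⟨by linarith [ht.1], by linarith [ht.2]⟩, by ring_nf⟩

theorem IsPiecewiseC1.concatCurve (h₁ : IsPiecewiseC1 γ₁) (h₂ : IsPiecewiseC1 γ₂)
    (h : γ₁ 1 = γ₂ 0) : IsPiecewiseC1 (concatCurve γ₁ γ₂) := by
  obtain ⟨n, t, ht, ht0, htn, hc⟩ := h₁
  obtain ⟨m, s, hs, hs0, hsm, hd⟩ := h₂
  have hle : ∀ i ≤ n, t i ≤ 1 := fun i hi => htn ▸ ht hi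
  have hge : ∀ i, 0 ≤ s i := fun i => hs0 ▸ hs (Nat.zero_le i)
  -- The two partitions are halved and juxtaposed. The index `n` belongs to the first branch; both
  -- branches give `1 / 2` there.
  refine ⟨n + m, fun i => if i ≤ n then t i / 2 else (1 + s (i - n)) / 2,
    monotone_nat_of_le_succ fun i => ?_, by simp [ht0], ?_, fun i hi => ?_⟩
  · rcases lt_trichotomy i n with hi | rfl | hi
    · have := ht (Nat.le_succ i)
      simp only [hi.le, Nat.succ_le_of_lt hi, if_true]
      simpa using div_le_div_of_nonneg_right this zero_le_two
    · have := hge 1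
      simp [htn]
      linarith
    · have := hs (show i - n ≤ i + 1 - n by omega)
      simp only [not_le.2 hi, not_le.2 (hi.trans (Nat.lt_succ_self i)), if_false]
      linarith
  · rcases Nat.eq_zero_or_pos m with rfl | hm
    · rw [hs0] at hsm
      exact absurd hsm zero_ne_one
    · have : ¬ n + m ≤ n := by omega
      simp [this, hsm]
  · rcases lt_or_ge i n with hin | hin
    · simp only [hin.le, Nat.succ_le_of_lt hin, if_true]
      refine ContDiffOn.congr (f := fun t => γ₁ (2 * t)) ?_ fun x hx => ?_
      · refine (hc i hin).comp (by fun_prop) fun x hx => ?_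
        exact ⟨by linarith [hx.1], by linarith [hx.2]⟩
      · have := hle (i + 1) hin
        exact concatCurve_eqOn_left (mem_Iic.2 (by linarith [hx.2]))
    · have h1 : ¬ i + 1 ≤ n := by omega
      have h2 : (if i ≤ n then t i / 2 else (1 + s (i - n)) / 2) = (1 + s (i - n)) / 2 := by
        rcases hin.eq_or_lt with rfl | hin
        · simp [htn, hs0]
        · simp [not_le.2 hin]
      have h3 : i + 1 - n = i - n + 1 := by omega
      simp only [h1, if_false, h2, h3]
      refine ContDiffOn.congr (f := fun t => γ₂ (2 * t - 1)) ?_ fun x hx => ?_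
      · refine (hd (i - n) (by omega)).comp (by fun_prop) fun x hx => ?_
        exact ⟨by linarith [hx.1], by linarith [hx.2]⟩
      · have := hge (i - n)
        exact concatCurve_eqOn_right h (mem_Ici.2 (by linarith [hx.1]))

/-- Each half is a linear substitution whose factor `2` from the chain rule is absorbed by the
change of variable. The formulas for the derivative are needed only on the open halves. -/
theorem contourIntegral_concatCurve (h₁ : IsPiecewiseC1 γ₁) (h₂ : IsPiecewiseC1 γ₂)
    (h : γ₁ 1 = γ₂ 0) {g : ℂ → B} (hg₁ : ContinuousOn g (γ₁ '' Icc 0 1))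
    (hg₂ : ContinuousOn g (γ₂ '' Icc 0 1)) :
    contourIntegral (concatCurve γ₁ γ₂) g = contourIntegral γ₁ g + contourIntegral γ₂ g := by
  set f := fun t => deriv (concatCurve γ₁ γ₂) t • g (concatCurve γ₁ γ₂ t) with hf
  have e₁ : EqOn (fun t => (2 : ℝ) • (deriv γ₁ (2 * t) • g (γ₁ (2 * t)))) f
      (uIoo 0 (1 / 2)) := by
    intro t ht
    rw [uIoo_of_le (by norm_num)] at ht
    have : concatCurve γ₁ γ₂ =ᶠ[𝓝 t] fun t => γ₁ (2 * t) := by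
      filter_upwards [Iio_mem_nhds ht.2] with x hx
      exact concatCurve_eqOn_left (mem_Iic.2 (le_of_lt hx))
    simp only [hf, this.deriv_eq, this.eq_of_nhds]
    rw [deriv_comp_mul_left, smul_assoc]
  have e₂ : EqOn (fun t => (2 : ℝ) • (deriv γ₂ (2 * t - 1) • g (γ₂ (2 * t - 1)))) f
      (uIoo (1 / 2) 1) := by
    intro t ht
    rw [uIoo_of_le (by norm_num)] at ht
    have : concatCurve γ₁ γ₂ =ᶠ[𝓝 t] fun t => γ₂ (2 * t - 1) := by
      filter_upwards [Ioi_mem_nhds ht.1] with x hx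
      exact concatCurve_eqOn_right h (mem_Ici.2 (le_of_lt hx))
    simp only [hf, this.deriv_eq, this.eq_of_nhds]
    rw [deriv_comp_mul_left (c := 2) (f := fun t => γ₂ (t - 1)), deriv_comp_sub_const, smul_assoc]
  have i₀ : IntervalIntegrable f volume 0 1 := by
    refine (h₁.concatCurve h₂ h).intervalIntegrable ?_
    rw [image_concatCurve h]
    exact hg₁.union_of_isClosed hg₂ h₁.isCompact_image.isClosed h₂.isCompact_image.isClosed
  have i₁ : IntervalIntegrable f volume 0 (1 / 2) := i₀.mono_set (by
    rw [uIcc_of_le (by norm_num), uIcc_of_le (by norm_num)]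
    exact Icc_subset_Icc_right (by norm_num))
  have i₂ : IntervalIntegrable f volume (1 / 2) 1 := i₀.mono_set (by
    rw [uIcc_of_le (by norm_num), uIcc_of_le (by norm_num)]
    exact Icc_subset_Icc_left (by norm_num))
  rw [contourIntegral, ← intervalIntegral.integral_add_adjacent_intervals i₁ i₂,
    ← intervalIntegral.integral_congr_uIoo e₁, ← intervalIntegral.integral_congr_uIoo e₂,
    intervalIntegral.integral_smul, intervalIntegral.integral_smul,
    intervalIntegral.smul_integral_comp_mul_left (f := fun t => deriv γ₁ t • g (γ₁ t)),
    intervalIntegral.smul_integral_comp_mul_sub (f := fun t => deriv γ₂ t • g (γ₂ t))]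
  norm_num [contourIntegral]

/-- A balanced list of arcs can be concatenated to a list of closed curves. -/
theorem exists_closed_curves_of_balanced (L : List (ℝ → ℂ)) (hL : ∀ γ ∈ L, IsPiecewiseC1 γ)
    (hbal : ∀ φ : ℂ → ℤ, (L.map fun γ => φ (γ 1) - φ (γ 0)).sum = 0) :
    ∃ M : List (ℝ → ℂ), (∀ γ ∈ M, IsPiecewiseC1 γ ∧ γ 0 = γ 1) ∧
      (⋃ γ ∈ M, γ '' Icc 0 1) = (⋃ γ ∈ L, γ '' Icc 0 1) ∧
      ∀ g : ℂ → B, ContinuousOn g (⋃ γ ∈ L, γ '' Icc 0 1) →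
        (M.map fun γ => contourIntegral γ g).sum = (L.map fun γ => contourIntegral γ g).sum := by
  induction hn : L.length using Nat.strong_induction_on generalizing L with
  | _ n ih =>
  rcases L with _ | ⟨γ, L⟩
  · exact ⟨[], by simp, by simp, by simp⟩
  by_cases hγ : γ 0 = γ 1
  · obtain ⟨M, hM, hMi, hMg⟩ := ih L.length (by simp [← hn]) L
      (fun γ' h => hL γ' (List.mem_cons_of_mem _ h)) (fun φ => by simpa [hγ] using hbal φ) rfl
    refine ⟨γ :: M, ?_, by simp [hMi], fun g hg => ?_⟩
    · rintro γ' (_ | ⟨_, h⟩)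
      exacts [⟨hL _ (by simp), hγ⟩, hM γ' h]
    · simp [hMg g (hg.mono (by simp))]
  -- Test the balance against the indicator of the endpoint of `γ`. The open arc `γ` contributes
  -- `1`; if no arc started there, the others would contribute nonnegative amounts, and the sum
  -- could not vanish.
  · obtain ⟨γ', hγ', hγγ'⟩ : ∃ γ' ∈ L, γ 1 = γ' 0 := by
      by_contra! hne
      have h := hbal fun z => if z = γ 1 then 1 else 0
      have h' : 0 ≤ (L.map fun γ' => (if γ' 1 = γ 1 then (1 : ℤ) else 0) -
          (if γ' 0 = γ 1 then 1 else 0)).sum := by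
        refine List.sum_nonneg fun x hx => ?_
        obtain ⟨γ', h1, rfl⟩ := List.mem_map.1 hx
        simp only [(hne γ' h1).symm, if_false]
        split_ifs <;> simp
      simp only [List.map_cons, List.sum_cons, hγ, if_true, if_false] at h
      linarith
    obtain ⟨L', hL'⟩ : ∃ L', L.Perm (γ' :: L') := by
      classical exact ⟨_, List.perm_cons_erase hγ'⟩
    have hmem : ∀ γ'', γ'' ∈ L ↔ γ'' = γ' ∨ γ'' ∈ L' := fun γ'' => by
      rw [hL'.mem_iff, List.mem_cons]
    have p₁ : IsPiecewiseC1 γ := hL γ (by simp)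
    have p₂ : IsPiecewiseC1 γ' := hL γ' (List.mem_cons_of_mem _ hγ')
    -- Joining two arcs shortens the list by one, and the common endpoint cancels from the balance.
    obtain ⟨M, hM, hMi, hMg⟩ := ih (concatCurve γ γ' :: L').length
      (by simp [← hn, hL'.length_eq]) (concatCurve γ γ' :: L')
      (by
        rintro γ'' (_ | ⟨_, h⟩)
        exacts [p₁.concatCurve p₂ hγγ', hL γ'' (List.mem_cons_of_mem _ ((hmem _).2 (Or.inr h)))])
      (fun φ => by
        have := hbal φ
        rw [List.map_cons, List.sum_cons, (hL'.map _).sum_eq, List.map_cons, List.sum_cons] at this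
        rw [List.map_cons, List.sum_cons, concatCurve_zero, concatCurve_one, ← this, hγγ']
        ring) rfl
    have hU : (⋃ γ'' ∈ concatCurve γ γ' :: L', γ'' '' Icc 0 1) =
        ⋃ γ'' ∈ γ :: L, γ'' '' Icc 0 1 := by
      simp only [List.mem_cons, hmem, iUnion_iUnion_eq_or_left, image_concatCurve hγγ',
        union_assoc]
    refine ⟨M, hM, hMi.trans hU, fun g hg => ?_⟩
    rw [hMg g (hU ▸ hg), List.map_cons, List.sum_cons, List.map_cons, List.sum_cons,
      (hL'.map _).sum_eq, List.map_cons, List.sum_cons, ← add_assoc,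
      contourIntegral_concatCurve p₁ p₂ hγγ']
    · exact hg.mono (subset_biUnion_of_mem (u := fun γ : ℝ → ℂ => γ '' Icc 0 1)
        (show γ ∈ {γ' | γ' ∈ γ :: L} by simp))
    · exact hg.mono (subset_biUnion_of_mem (u := fun γ : ℝ → ℂ => γ '' Icc 0 1)
        (show γ' ∈ {γ' | γ' ∈ γ :: L} by simp [hγ']))

end Concatenation

/-! ### Segments and rectangles -/

/-- The segment from `p` to `q`, parametrized by `[0, 1]`. -/
def segmentCurve (p q : ℂ) : ℝ → ℂ := fun t => p + t • (q - p)

theorem isPiecewiseC1_segmentCurve (p q : ℂ) : IsPiecewiseC1 (segmentCurve p q) := by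
  refine ⟨1, fun i => i, Nat.mono_cast, by simp, by simp, fun i _ => ?_⟩
  refine ContDiff.contDiffOn ?_
  unfold segmentCurve
  fun_prop

theorem segmentCurve_zero (p q : ℂ) : segmentCurve p q 0 = p := by simp [segmentCurve]

theorem segmentCurve_one (p q : ℂ) : segmentCurve p q 1 = q := by simp [segmentCurve]

theorem image_segmentCurve (p q : ℂ) : segmentCurve p q '' Icc 0 1 = segment ℝ p q :=
  (segment_eq_image' ℝ p q).symm

theorem hasDerivAt_segmentCurve (p q : ℂ) (t : ℝ) :
    HasDerivAt (segmentCurve p q) (q - p) t := by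
  have h := ((hasDerivAt_id t).smul_const (q - p)).const_add p
  rw [one_smul] at h
  exact h

theorem contourIntegral_segmentCurve (p q : ℂ) (g : ℂ → ℂ) :
    contourIntegral (segmentCurve p q) g = ∫ t in (0 : ℝ)..1, (q - p) * g (p + t • (q - p)) := by
  simp only [contourIntegral, (hasDerivAt_segmentCurve p q _).deriv, smul_eq_mul]
  rfl

theorem contourIntegral_segmentCurve_swap (p q : ℂ) (g : ℂ → ℂ) :
    contourIntegral (segmentCurve q p) g = -contourIntegral (segmentCurve p q) g := by
  rw [contourIntegral_segmentCurve, contourIntegral_segmentCurve,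
    ← intervalIntegral.integral_neg]
  have := intervalIntegral.integral_comp_sub_left (a := 0) (b := 1)
    (fun t : ℝ => -((q - p) * g (p + t • (q - p)))) 1
  rw [sub_self, sub_zero] at this
  rw [← this]
  refine intervalIntegral.integral_congr fun t _ => ?_
  have : p + (1 - t) • (q - p) = q + t • (p - q) := by
    simp only [Complex.real_smul]
    push_cast
    ring
  simp only [this]
  ring

theorem contourIntegral_segmentCurve_of_hasDerivAt {p q : ℂ} {f g : ℂ → ℂ}
    (h : ∀ z ∈ segment ℝ p q, HasDerivAt f (g z) z) (hg : ContinuousOn g (segment ℝ p q)) :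
    contourIntegral (segmentCurve p q) g = f q - f p := by
  rw [← image_segmentCurve] at h hg
  have := intervalIntegral.integral_eq_sub_of_hasDerivAt (a := 0) (b := 1)
    (f := fun t => f (segmentCurve p q t))
    (f' := fun t => deriv (segmentCurve p q) t • g (segmentCurve p q t)) ?_
    ((isPiecewiseC1_segmentCurve p q).intervalIntegrable hg)
  · rwa [segmentCurve_zero, segmentCurve_one] at this
  · intro t ht
    rw [uIcc_of_le zero_le_one] at ht
    have hd := hasDerivAt_segmentCurve p q t
    rw [hd.deriv]
    exact (h _ (mem_image_of_mem _ ht)).scomp t hd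

theorem contourIntegral_horizontal (a b c : ℝ) (g : ℂ → ℂ) :
    contourIntegral (segmentCurve ⟨a, c⟩ ⟨b, c⟩) g = ∫ x in a..b, g (x + c * Complex.I) := by
  have := intervalIntegral.smul_integral_comp_add_mul (a := 0) (b := 1)
    (fun x : ℝ => g (x + c * Complex.I)) (b - a) a
  rw [mul_zero, mul_one, add_zero, add_sub_cancel] at this
  rw [contourIntegral_segmentCurve, ← this, ← intervalIntegral.integral_smul]
  refine intervalIntegral.integral_congr fun t _ => ?_
  simp only [Complex.real_smul]
  congr 1
  · apply Complex.ext <;> simp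
  · congr 1
    apply Complex.ext <;> simp
    ring

theorem contourIntegral_vertical (a c d : ℝ) (g : ℂ → ℂ) :
    contourIntegral (segmentCurve ⟨a, c⟩ ⟨a, d⟩) g =
      Complex.I * ∫ y in c..d, g (a + y * Complex.I) := by
  have := intervalIntegral.smul_integral_comp_add_mul (a := 0) (b := 1)
    (fun y : ℝ => g (a + y * Complex.I)) (d - c) c
  rw [mul_zero, mul_one, add_zero, add_sub_cancel] at this
  rw [contourIntegral_segmentCurve, ← this, ← intervalIntegral.integral_smul,
    ← intervalIntegral.integral_const_mul]
  refine intervalIntegral.integral_congr fun t _ => ?_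
  simp only [Complex.real_smul]
  rw [← mul_assoc]
  congr 1
  · apply Complex.ext <;> simp
  · congr 1
    apply Complex.ext <;> simp
    ring

/-- The integral over the positively oriented boundary of a rectangle. -/
def rectIntegral (a b c d : ℝ) (g : ℂ → ℂ) : ℂ :=
  contourIntegral (segmentCurve ⟨a, c⟩ ⟨b, c⟩) g + contourIntegral (segmentCurve ⟨b, c⟩ ⟨b, d⟩) g +
    contourIntegral (segmentCurve ⟨b, d⟩ ⟨a, d⟩) g + contourIntegral (segmentCurve ⟨a, d⟩ ⟨a, c⟩) g

theorem rectIntegral_eq_zero {a b c d : ℝ} (hab : a ≤ b) (hcd : c ≤ d) {g : ℂ → ℂ}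
    (hg : DifferentiableOn ℂ g (Icc a b ×ℂ Icc c d)) : rectIntegral a b c d g = 0 := by
  have := Complex.integral_boundary_rect_eq_zero_of_differentiableOn g ⟨a, c⟩ ⟨b, d⟩
    (by simpa only [uIcc_of_le hab, uIcc_of_le hcd] using hg)
  rw [rectIntegral, contourIntegral_segmentCurve_swap ⟨a, d⟩, contourIntegral_segmentCurve_swap
    ⟨a, c⟩ ⟨a, d⟩, contourIntegral_horizontal, contourIntegral_horizontal,
    contourIntegral_vertical, contourIntegral_vertical]
  simp only [smul_eq_mul] at this
  linear_combination this

/-- On the bottom, right and top sides the principal logarithm of `w - z` is a primitive. The left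
side crosses the branch cut, so there `log (-(w - z))` is used. The two branches differ by `πi` at
the lower left corner and by `-πi` at the upper left one, and these jumps add up to `2πi`. -/
theorem rectIntegral_sub_inv {a b c d : ℝ} {z : ℂ} (hz : z ∈ Ioo a b ×ℂ Ioo c d) :
    rectIntegral a b c d (fun w => (w - z)⁻¹) = 2 * Real.pi * Complex.I := by
  obtain ⟨⟨h1, h2⟩, h3, h4⟩ := hz
  have key : ∀ p q : ℂ, (∀ w ∈ segment ℝ p q, w - z ∈ Complex.slitPlane) →
      contourIntegral (segmentCurve p q) (fun w => (w - z)⁻¹) =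
        Complex.log (q - z) - Complex.log (p - z) := by
    intro p q h
    refine contourIntegral_segmentCurve_of_hasDerivAt (f := fun w => Complex.log (w - z))
      (fun w hw => ?_) ?_
    · simpa using ((hasDerivAt_id w).sub_const z).clog (h w hw)
    · exact ContinuousOn.inv₀ (by fun_prop) fun w hw => Complex.slitPlane_ne_zero (h w hw)
  have e1 := key ⟨a, c⟩ ⟨b, c⟩ fun w hw => Or.inr (by
    have : w.im < z.im := (convex_halfSpace_im_lt z.im).segment_subset
      (show c < z.im from h3) (show c < z.im from h3) hw
    rw [Complex.sub_im]
    exact (sub_neg.2 this).ne)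
  have e2 := key ⟨b, c⟩ ⟨b, d⟩ fun w hw => Or.inl (by
    have : z.re < w.re := (convex_halfSpace_re_gt z.re).segment_subset
      (show z.re < b from h2) (show z.re < b from h2) hw
    rw [Complex.sub_re]
    exact sub_pos.2 this)
  have e3 := key ⟨b, d⟩ ⟨a, d⟩ fun w hw => Or.inr (by
    have : z.im < w.im := (convex_halfSpace_im_gt z.im).segment_subset
      (show z.im < d from h4) (show z.im < d from h4) hw
    rw [Complex.sub_im]
    exact (sub_pos.2 this).ne')
  have e4 : contourIntegral (segmentCurve ⟨a, d⟩ ⟨a, c⟩) (fun w => (w - z)⁻¹) =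
      Complex.log (-(⟨a, c⟩ - z)) - Complex.log (-(⟨a, d⟩ - z)) := by
    have hs : ∀ w ∈ segment ℝ (⟨a, d⟩ : ℂ) ⟨a, c⟩, -(w - z) ∈ Complex.slitPlane :=
        fun w hw => Or.inl (by
      have : w.re < z.re := (convex_halfSpace_re_lt z.re).segment_subset
        (show a < z.re from h1) (show a < z.re from h1) hw
      rw [neg_sub, Complex.sub_re]
      exact sub_pos.2 this)
    refine contourIntegral_segmentCurve_of_hasDerivAt (f := fun w => Complex.log (-(w - z)))
      (fun w hw => ?_) ?_
    · have h := ((hasDerivAt_id w).sub_const z).neg.clog (hs w hw)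
      refine h.congr_deriv ?_
      change -1 / -(w - z) = _
      rw [neg_div_neg_eq, one_div]
    · exact ContinuousOn.inv₀ (by fun_prop) fun w hw =>
        neg_ne_zero.1 (Complex.slitPlane_ne_zero (hs w hw))
  have l1 : Complex.log (-(⟨a, c⟩ - z)) = Complex.log (⟨a, c⟩ - z) + Real.pi * Complex.I := by
    have : ((⟨a, c⟩ : ℂ) - z).im < 0 := by
      rw [Complex.sub_im]
      exact sub_neg.2 h3
    rw [Complex.log, Complex.log, norm_neg, Complex.arg_neg_eq_arg_add_pi_of_im_neg this]
    push_cast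
    ring
  have l2 : Complex.log (-(⟨a, d⟩ - z)) = Complex.log (⟨a, d⟩ - z) - Real.pi * Complex.I := by
    have : 0 < ((⟨a, d⟩ : ℂ) - z).im := by
      rw [Complex.sub_im]
      exact sub_pos.2 h4
    rw [Complex.log, Complex.log, norm_neg, Complex.arg_neg_eq_arg_sub_pi_of_im_pos this]
    push_cast
    ring
  rw [rectIntegral, e1, e2, e3, e4, l1, l2]
  ring

/-! ### Boundaries of finite unions of lattice squares -/

/-- The oriented edges of the lattice square with lower left corner `s`. -/
def squareEdges (s : ℤ × ℤ) : Finset ((ℤ × ℤ) × (ℤ × ℤ)) :=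
  {((s.1, s.2), (s.1 + 1, s.2)), ((s.1 + 1, s.2), (s.1 + 1, s.2 + 1)),
    ((s.1 + 1, s.2 + 1), (s.1, s.2 + 1)), ((s.1, s.2 + 1), (s.1, s.2))}

theorem mem_squareEdges {s : ℤ × ℤ} {e : (ℤ × ℤ) × (ℤ × ℤ)} : e ∈ squareEdges s ↔
    e = ((s.1, s.2), (s.1 + 1, s.2)) ∨ e = ((s.1 + 1, s.2), (s.1 + 1, s.2 + 1)) ∨
      e = ((s.1 + 1, s.2 + 1), (s.1, s.2 + 1)) ∨ e = ((s.1, s.2 + 1), (s.1, s.2)) := by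
  simp [squareEdges]

theorem sum_squareEdges {M : Type*} [AddCommMonoid M] (s : ℤ × ℤ)
    (f : (ℤ × ℤ) × (ℤ × ℤ) → M) :
    ∑ e ∈ squareEdges s, f e = f ((s.1, s.2), (s.1 + 1, s.2)) +
      f ((s.1 + 1, s.2), (s.1 + 1, s.2 + 1)) + f ((s.1 + 1, s.2 + 1), (s.1, s.2 + 1)) +
      f ((s.1, s.2 + 1), (s.1, s.2)) := by
  obtain ⟨m, n⟩ := s
  rw [squareEdges, Finset.sum_insert, Finset.sum_insert, Finset.sum_insert, Finset.sum_singleton]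
  · simp only [add_assoc]
  all_goals simp

/-- A positively oriented square lies to the left of its edges, so an oriented edge determines its
square. -/
theorem eq_of_mem_squareEdges {s s' : ℤ × ℤ} {e : (ℤ × ℤ) × (ℤ × ℤ)} (h : e ∈ squareEdges s)
    (h' : e ∈ squareEdges s') : s = s' := by
  rw [mem_squareEdges] at h h'
  obtain ⟨m, n⟩ := s
  obtain ⟨m', n'⟩ := s'
  rcases h with rfl | rfl | rfl | rfl <;> simp only [Prod.mk.injEq] at h' ⊢ <;> omega

/-- The oriented edges of the squares in `S` that belong to one square of `S` only. -/
def boundaryEdges (S : Finset (ℤ × ℤ)) : Finset ((ℤ × ℤ) × (ℤ × ℤ)) :=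
  {e ∈ S.biUnion squareEdges | e.swap ∉ S.biUnion squareEdges}

/-- The contributions of the interior edges cancel. -/
theorem sum_boundaryEdges {M : Type*} [AddCommGroup M] (S : Finset (ℤ × ℤ))
    (f : (ℤ × ℤ) × (ℤ × ℤ) → M) (hf : ∀ e, f e.swap = -f e) :
    ∑ e ∈ boundaryEdges S, f e = ∑ s ∈ S, ∑ e ∈ squareEdges s, f e := by
  rw [← Finset.sum_biUnion, ← Finset.sum_filter_not_add_sum_filter (S.biUnion squareEdges)
    (fun e => e.swap ∉ S.biUnion squareEdges), boundaryEdges, right_eq_add]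
  -- The discarded edges are paired with their reversals. No edge is its own reversal, since its
  -- endpoints differ.
  · refine Finset.sum_involution (fun e _ => e.swap) (fun e _ => by simp [hf]) ?_ ?_ (by simp)
    · intro e he _ h
      obtain ⟨⟨m, n⟩, _, hs⟩ := Finset.mem_biUnion.1 (Finset.mem_filter.1 he).1
      rw [mem_squareEdges] at hs
      rcases hs with rfl | rfl | rfl | rfl <;> simp at h
    · intro e he
      rw [Finset.mem_filter, not_not] at he ⊢
      exact ⟨he.2, by simpa using he.1⟩
  · intro s _ s' _ hne
    exact Finset.disjoint_left.2 fun e h₁ h₂ => hne (eq_of_mem_squareEdges h₁ h₂)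

/-- The point of the lattice of mesh `h` with the integral coordinates `v`. -/
def latticePoint (h : ℝ) (v : ℤ × ℤ) : ℂ := ⟨v.1 * h, v.2 * h⟩

/-- The edge `e` of the lattice of mesh `h`, as a curve. -/
def edgeCurve (h : ℝ) (e : (ℤ × ℤ) × (ℤ × ℤ)) : ℝ → ℂ :=
  segmentCurve (latticePoint h e.1) (latticePoint h e.2)

/-- The closed square of the lattice of mesh `h` with lower left corner `s`. -/
def latticeSquare (h : ℝ) (s : ℤ × ℤ) : Set ℂ :=
  Icc (s.1 * h) ((s.1 + 1) * h) ×ℂ Icc (s.2 * h) ((s.2 + 1) * h)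

/-- The open square of the lattice of mesh `h` with lower left corner `s`. -/
def openLatticeSquare (h : ℝ) (s : ℤ × ℤ) : Set ℂ :=
  Ioo (s.1 * h) ((s.1 + 1) * h) ×ℂ Ioo (s.2 * h) ((s.2 + 1) * h)

theorem sum_squareEdges_contourIntegral (h : ℝ) (s : ℤ × ℤ) (g : ℂ → ℂ) :
    ∑ e ∈ squareEdges s, contourIntegral (edgeCurve h e) g =
      rectIntegral (s.1 * h) ((s.1 + 1) * h) (s.2 * h) ((s.2 + 1) * h) g := by
  simp [sum_squareEdges, rectIntegral, edgeCurve, latticePoint]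

theorem closure_openLatticeSquare {h : ℝ} (hh : 0 < h) (s : ℤ × ℤ) :
    closure (openLatticeSquare h s) = latticeSquare h s := by
  rw [openLatticeSquare, Complex.closure_reProdIm, closure_Ioo, closure_Ioo, latticeSquare]
  all_goals nlinarith

theorem convex_latticeSquare (h : ℝ) (s : ℤ × ℤ) : Convex ℝ (latticeSquare h s) :=
  ((convex_Icc _ _).linear_preimage Complex.reLm).inter
    ((convex_Icc _ _).linear_preimage Complex.imLm)

theorem isCompact_latticeSquare (h : ℝ) (s : ℤ × ℤ) : IsCompact (latticeSquare h s) :=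
  isCompact_Icc.reProdIm isCompact_Icc

theorem exists_mem_latticeSquare {h : ℝ} (hh : 0 < h) (z : ℂ) : ∃ s, z ∈ latticeSquare h s := by
  have key : ∀ x : ℝ, x ∈ Icc (⌊x / h⌋ * h) ((⌊x / h⌋ + 1) * h) := fun x =>
    ⟨(le_div_iff₀ hh).1 (Int.floor_le _), ((div_lt_iff₀ hh).1 (Int.lt_floor_add_one _)).le⟩
  exact ⟨(⌊z.re / h⌋, ⌊z.im / h⌋), key _, key _⟩

theorem eq_of_mem_openLatticeSquare {h : ℝ} (hh : 0 < h) {s s' : ℤ × ℤ} {z : ℂ}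
    (hz : z ∈ openLatticeSquare h s) (hz' : z ∈ latticeSquare h s') : s = s' := by
  have key : ∀ {m n : ℤ} {x : ℝ}, x ∈ Ioo (m * h) ((m + 1) * h) →
      x ∈ Icc (n * h) ((n + 1) * h) → m = n := by
    intro m n x hx hx'
    have h1 : (m : ℝ) < n + 1 := lt_of_mul_lt_mul_right (hx.1.trans_le hx'.2) hh.le
    have h2 : (n : ℝ) < m + 1 := lt_of_mul_lt_mul_right (hx'.1.trans_lt hx.2) hh.le
    norm_cast at h1 h2
    omega
  exact Prod.ext (key hz.1 hz'.1) (key hz.2 hz'.2)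

theorem image_edgeCurve_subset {h : ℝ} (hh : 0 < h) {s : ℤ × ℤ} {e : (ℤ × ℤ) × (ℤ × ℤ)}
    (he : e ∈ squareEdges s) : edgeCurve h e '' Icc 0 1 ⊆ latticeSquare h s := by
  rw [edgeCurve, image_segmentCurve]
  rw [mem_squareEdges] at he
  have h1 : (s.1 : ℝ) * h ≤ (s.1 + 1) * h := by nlinarith
  have h2 : (s.2 : ℝ) * h ≤ (s.2 + 1) * h := by nlinarith
  refine (convex_latticeSquare h s).segment_subset ?_ ?_ <;>
  rcases he with rfl | rfl | rfl | rfl <;>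
  simp [latticePoint, latticeSquare, Complex.mem_reProdIm, h1, h2]

/-- The neighbouring square across the edge carries it with the opposite orientation. -/
theorem exists_mem_swap_squareEdges {s : ℤ × ℤ} {e : (ℤ × ℤ) × (ℤ × ℤ)}
    (he : e ∈ squareEdges s) : ∃ s', e.swap ∈ squareEdges s' := by
  simp only [mem_squareEdges] at he ⊢
  rcases he with rfl | rfl | rfl | rfl
  · exact ⟨(s.1, s.2 - 1), by simp⟩
  · exact ⟨(s.1 + 1, s.2), by simp⟩
  · exact ⟨(s.1, s.2 + 1), by simp⟩
  · exact ⟨(s.1 - 1, s.2), by simp⟩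

theorem image_edgeCurve_swap (h : ℝ) (e : (ℤ × ℤ) × (ℤ × ℤ)) :
    edgeCurve h e.swap '' Icc 0 1 = edgeCurve h e '' Icc 0 1 := by
  simp only [edgeCurve, image_segmentCurve, Prod.fst_swap, Prod.snd_swap, segment_symm]

theorem sum_boundaryEdges_contourIntegral (h : ℝ) (S : Finset (ℤ × ℤ)) (g : ℂ → ℂ) :
    ∑ e ∈ boundaryEdges S, contourIntegral (edgeCurve h e) g =
      ∑ s ∈ S, rectIntegral (s.1 * h) ((s.1 + 1) * h) (s.2 * h) ((s.2 + 1) * h) g := by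
  rw [sum_boundaryEdges S _ fun e => contourIntegral_segmentCurve_swap _ _ _]
  exact Finset.sum_congr rfl fun s _ => sum_squareEdges_contourIntegral h s g

/-- The trace of the boundary of the union of the lattice squares in `S`. -/
def boundaryTrace (h : ℝ) (S : Finset (ℤ × ℤ)) : Set ℂ :=
  ⋃ e ∈ boundaryEdges S, edgeCurve h e '' Icc 0 1

theorem isCompact_boundaryTrace (h : ℝ) (S : Finset (ℤ × ℤ)) : IsCompact (boundaryTrace h S) :=
  (boundaryEdges S).finite_toSet.isCompact_biUnion fun _ _ =>
    (isPiecewiseC1_segmentCurve _ _).isCompact_image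

theorem boundaryTrace_subset {h : ℝ} (hh : 0 < h) (S : Finset (ℤ × ℤ)) :
    boundaryTrace h S ⊆ ⋃ s ∈ S, latticeSquare h s := by
  refine iUnion₂_subset fun e he => ?_
  obtain ⟨s, hs, hes⟩ := Finset.mem_biUnion.1 (Finset.mem_filter.1 he).1
  exact (image_edgeCurve_subset hh hes).trans (subset_biUnion_of_mem (u := latticeSquare h) hs)

/-- A boundary edge lies in two closed squares, one in `S` and its neighbour, which is not in `S`. A
point of an open square lies in only one closed square. -/
theorem disjoint_openLatticeSquare_boundaryTrace {h : ℝ} (hh : 0 < h) (S : Finset (ℤ × ℤ))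
    (s : ℤ × ℤ) : Disjoint (openLatticeSquare h s) (boundaryTrace h S) := by
  refine Set.disjoint_left.2 fun z hz hz' => ?_
  obtain ⟨e, he, hze⟩ := mem_iUnion₂.1 hz'
  obtain ⟨s₁, _, he₁⟩ := Finset.mem_biUnion.1 (Finset.mem_filter.1 he).1
  obtain ⟨s₂, he₂⟩ := exists_mem_swap_squareEdges he₁
  have h₁ := eq_of_mem_openLatticeSquare hh hz (image_edgeCurve_subset hh he₁ hze)
  have h₂ := eq_of_mem_openLatticeSquare hh hz
    (image_edgeCurve_subset hh he₂ (by rwa [image_edgeCurve_swap]))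
  exact (Finset.mem_filter.1 he).2 (Finset.mem_biUnion.2 ⟨s₁, ‹_›, by rwa [← h₁, h₂]⟩)

/-- The square across a boundary edge contains that edge but is not in `S`. This keeps the enclosed
compact set off the boundary. -/
theorem notMem_boundaryTrace {h : ℝ} (hh : 0 < h) {S : Finset (ℤ × ℤ)} {z : ℂ}
    (hz : ∀ s, z ∈ latticeSquare h s → s ∈ S) : z ∉ boundaryTrace h S := by
  intro hz'
  obtain ⟨e, he, hze⟩ := mem_iUnion₂.1 hz'
  obtain ⟨s₁, _, he₁⟩ := Finset.mem_biUnion.1 (Finset.mem_filter.1 he).1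
  obtain ⟨s₂, he₂⟩ := exists_mem_swap_squareEdges he₁
  exact (Finset.mem_filter.1 he).2 (Finset.mem_biUnion.2 ⟨s₂, hz _
    (image_edgeCurve_subset hh he₂ (by rwa [image_edgeCurve_swap])), he₂⟩)

theorem continuousAt_sum_boundaryEdges {h : ℝ} {S : Finset (ℤ × ℤ)} {z : ℂ}
    (hz : z ∉ boundaryTrace h S) :
    ContinuousAt (fun z => ∑ e ∈ boundaryEdges S,
      contourIntegral (edgeCurve h e) (fun w => (w - z)⁻¹)) z := by
  refine tendsto_finsetSum _ fun e he => ?_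
  exact continuousAt_contourIntegral_sub_inv (isPiecewiseC1_segmentCurve _ _) fun hze =>
    hz (mem_biUnion he hze)

/-- The index of the boundary of a union of lattice squares. -/
theorem sum_boundaryEdges_sub_inv {h : ℝ} (hh : 0 < h) {S : Finset (ℤ × ℤ)} {z : ℂ} {s : ℤ × ℤ}
    (hzs : z ∈ latticeSquare h s) (hz : z ∉ boundaryTrace h S) :
    ∑ e ∈ boundaryEdges S, contourIntegral (edgeCurve h e) (fun w => (w - z)⁻¹) =
      if s ∈ S then 2 * Real.pi * Complex.I else 0 := by
  have hopen : ∀ z ∈ openLatticeSquare h s,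
      ∑ e ∈ boundaryEdges S, contourIntegral (edgeCurve h e) (fun w => (w - z)⁻¹) =
        if s ∈ S then 2 * Real.pi * Complex.I else 0 := by
    intro z hz
    -- The right side becomes a sum over `S`, so the comparison is square by square: the square
    -- containing `z` gives `2πi`, and the others give `0` by Cauchy's theorem.
    rw [sum_boundaryEdges_contourIntegral, ← Finset.sum_ite_eq S s
      (fun _ => (2 * Real.pi * Complex.I : ℂ))]
    refine Finset.sum_congr rfl fun s' _ => ?_
    split_ifs with hs
    · subst hs
      exact rectIntegral_sub_inv hz
    · refine rectIntegral_eq_zero (by nlinarith) (by nlinarith) fun w hw => ?_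
      have : w - z ≠ 0 := by
        intro h0
        rw [sub_eq_zero] at h0
        exact hs (eq_of_mem_openLatticeSquare hh hz (h0 ▸ hw))
      exact (((differentiableAt_id.sub_const z)).inv this).differentiableWithinAt
  -- A point on a side of the square but off the trace is a limit of points of the open square, and
  -- the sum is continuous there.
  rw [← closure_openLatticeSquare hh] at hzs
  have hlim := (continuousAt_sum_boundaryEdges hz).mono_left
    (nhdsWithin_le_nhds (s := openLatticeSquare h s))
  have : (𝓝[openLatticeSquare h s] z).NeBot := mem_closure_iff_nhdsWithin_neBot.1 hzs
  refine tendsto_nhds_unique hlim (tendsto_const_nhds.congr' ?_)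
  filter_upwards [self_mem_nhdsWithin] with w hw
  exact (hopen w hw).symm

theorem finite_setOf_latticeSquare_inter_nonempty {h : ℝ} (hh : 0 < h) {K : Set ℂ}
    (hK : IsCompact K) : {s | (latticeSquare h s ∩ K).Nonempty}.Finite := by
  obtain ⟨R, hR⟩ := hK.isBounded.subset_closedBall 0
  have key : ∀ {m : ℤ} {x : ℝ}, x ∈ Icc (m * h) ((m + 1) * h) → |x| ≤ R →
      m ∈ Icc ⌊-R / h - 1⌋ ⌈R / h⌉ := by
    intro m x hx hxR
    rw [abs_le] at hxR
    constructor
    · rw [← Int.cast_le (R := ℝ)]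
      refine (Int.floor_le _).trans ?_
      rw [sub_le_iff_le_add, div_le_iff₀ hh]
      linarith [hx.2]
    · rw [← Int.cast_le (R := ℝ)]
      refine le_trans ?_ (Int.le_ceil _)
      rw [le_div_iff₀ hh]
      linarith [hx.1]
  refine ((finite_Icc ⌊-R / h - 1⌋ ⌈R / h⌉).prod (finite_Icc ⌊-R / h - 1⌋ ⌈R / h⌉)).subset ?_
  rintro s ⟨z, hz, hzK⟩
  have hzR : ‖z‖ ≤ R := by simpa using hR hzK
  exact ⟨key hz.1 ((Complex.abs_re_le_norm z).trans hzR),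
    key hz.2 ((Complex.abs_im_le_norm z).trans hzR)⟩

theorem dist_le_of_mem_latticeSquare {h : ℝ} {s : ℤ × ℤ} {z w : ℂ}
    (hz : z ∈ latticeSquare h s) (hw : w ∈ latticeSquare h s) : dist z w ≤ 2 * h := by
  rw [dist_eq_norm]
  refine (Complex.norm_le_abs_re_add_abs_im _).trans ?_
  have h1 : |(z - w).re| ≤ h := by
    rw [Complex.sub_re, abs_le]
    constructor <;> linarith [hz.1.1, hz.1.2, hw.1.1, hw.1.2]
  have h2 : |(z - w).im| ≤ h := by
    rw [Complex.sub_im, abs_le]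
    constructor <;> linarith [hz.2.1, hz.2.2, hw.2.1, hw.2.2]
  linarith

/-- A compact subset of an open set is contained in a Cauchy domain, whose boundary is homologous
to zero in the open set. -/
theorem exists_cauchyDomain {K W : Set ℂ} (hK : IsCompact K) (hW : IsOpen W) (hKW : K ⊆ W) :
    ∃ D : CauchyDomain W, K ⊆ D.carrier ∧ ∀ g : ℂ → ℂ, DifferentiableOn ℂ g W →
      ∑ j, contourIntegral (D.curve j) g = 0 := by
  obtain ⟨δ, hδ, hδW⟩ := hK.exists_cthickening_subset_open hW hKW
  -- Two points of one square are at most `2 * h` apart, so a square meeting `K` stays in the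
  -- `δ`-thickening.
  obtain ⟨h, hh, hhδ⟩ : ∃ h : ℝ, 0 < h ∧ 2 * h ≤ δ := ⟨δ / 2, by positivity, by linarith⟩
  set S := (finite_setOf_latticeSquare_inter_nonempty hh hK).toFinset with hS
  have hmemS : ∀ {s}, s ∈ S ↔ (latticeSquare h s ∩ K).Nonempty := by simp [hS]
  have hQW : ∀ s ∈ S, latticeSquare h s ⊆ W := by
    intro s hs z hz
    obtain ⟨w, hw, hwK⟩ := hmemS.1 hs
    exact hδW (Metric.mem_cthickening_of_dist_le z w δ K hwK
      ((dist_le_of_mem_latticeSquare hz hw).trans hhδ))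
  set Q := ⋃ s ∈ S, latticeSquare h s with hQ
  have hQc : IsCompact Q := S.finite_toSet.isCompact_biUnion fun s _ => isCompact_latticeSquare h s
  set Γ := boundaryTrace h S with hΓ
  have hΓQ : Γ ⊆ Q := boundaryTrace_subset hh S
  have hsub : closure (Q \ Γ) ⊆ Q := closure_minimal sdiff_subset hQc.isClosed
  have hidx₁ : ∀ z ∈ Q \ Γ, ∑ e ∈ boundaryEdges S,
      contourIntegral (edgeCurve h e) (fun w => (w - z)⁻¹) = 2 * Real.pi * Complex.I := by
    rintro z ⟨hz, hzΓ⟩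
    obtain ⟨s, hs, hzs⟩ := mem_iUnion₂.1 hz
    rw [sum_boundaryEdges_sub_inv hh hzs hzΓ, if_pos hs]
  have hidx₀ : ∀ z ∉ Q, ∑ e ∈ boundaryEdges S,
      contourIntegral (edgeCurve h e) (fun w => (w - z)⁻¹) = 0 := by
    intro z hz
    obtain ⟨s, hs⟩ := exists_mem_latticeSquare hh z
    rw [sum_boundaryEdges_sub_inv hh hs (fun hz' => hz (hΓQ hz')), if_neg]
    exact fun h' => hz (mem_biUnion h' hs)
  -- The sum of integrals is `2πi` on `Q \ Γ`, zero off `Q`, and continuous off `Γ`. Near a point of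
  -- `Q \ Γ` it is nonzero, so nearby points cannot leave `Q`.
  have hopen : IsOpen (Q \ Γ) := by
    refine isOpen_iff_mem_nhds.2 fun z hz => ?_
    have hne := (continuousAt_sum_boundaryEdges hz.2).eventually_ne
      (by rw [hidx₁ z hz]; exact Complex.two_pi_I_ne_zero)
    filter_upwards [hne, (isCompact_boundaryTrace h S).isClosed.isOpen_compl.mem_nhds hz.2]
      with w hw hwΓ
    exact ⟨by_contra fun hwQ => hw (hidx₀ w hwQ), hwΓ⟩
  -- Each boundary edge is a side of a square of `S`, whose open square lies in `Q \ Γ`.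
  have hΓcl : Γ ⊆ closure (Q \ Γ) := by
    intro z hz
    obtain ⟨e, he, hze⟩ := mem_iUnion₂.1 hz
    obtain ⟨s, hs, hes⟩ := Finset.mem_biUnion.1 (Finset.mem_filter.1 he).1
    have hzs := image_edgeCurve_subset hh hes hze
    rw [← closure_openLatticeSquare hh] at hzs
    refine closure_mono (t := Q \ Γ) (fun w hw => ⟨?_, ?_⟩) hzs
    · refine mem_biUnion hs ?_
      rw [← closure_openLatticeSquare hh]
      exact subset_closure hw
    · exact Set.disjoint_left.1 (disjoint_openLatticeSquare_boundaryTrace hh S s) hw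
  -- The boundary edges are balanced: differences of `φ` change sign under reversal, so the sum may
  -- be taken over all squares, and around each square it telescopes to zero.
  obtain ⟨M, hM, hMΓ, hMg⟩ := exists_closed_curves_of_balanced (B := ℂ)
    ((boundaryEdges S).toList.map (edgeCurve h))
    (by
      intro γ hγ
      obtain ⟨e, _, rfl⟩ := List.mem_map.1 hγ
      exact isPiecewiseC1_segmentCurve _ _)
    (by
      intro φ
      rw [List.map_map, Finset.sum_map_toList]
      simp only [Function.comp_def, edgeCurve, segmentCurve_zero, segmentCurve_one]
      rw [sum_boundaryEdges S (fun e => φ (latticePoint h e.2) - φ (latticePoint h e.1))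
        (fun e => by simp)]
      refine Finset.sum_eq_zero fun s _ => ?_
      rw [sum_squareEdges]
      ring)
  have hLΓ : (⋃ γ ∈ (boundaryEdges S).toList.map (edgeCurve h), γ '' Icc (0 : ℝ) 1) = Γ := by
    ext z
    simp [hΓ, boundaryTrace]
  rw [hLΓ] at hMΓ hMg
  have hsum : ∀ g : ℂ → ℂ, ContinuousOn g Γ → ∑ j : Fin M.length, contourIntegral (M.get j) g =
      ∑ e ∈ boundaryEdges S, contourIntegral (edgeCurve h e) g := by
    intro g hg
    have h1 := hMg g hg
    rw [List.map_map, Finset.sum_map_toList] at h1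
    rw [← List.sum_ofFn]
    refine Eq.trans ?_ h1
    conv_rhs => rw [← List.ofFn_get M, List.map_ofFn]
    rfl
  have hcont : ∀ z ∉ Γ, ContinuousOn (fun w : ℂ => (w - z)⁻¹) Γ := fun z hz =>
    ContinuousOn.inv₀ (by fun_prop) fun w hw h0 => hz (sub_eq_zero.1 h0 ▸ hw)
  refine ⟨{ carrier := Q \ Γ
            isOpen := hopen
            isBounded := hQc.isBounded.subset sdiff_subset
            closure_subset := hsub.trans (iUnion₂_subset hQW)
            n := M.length
            curve := M.get
            piecewiseC1 := fun j => (hM _ (List.get_mem M j)).1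
            closed := fun j => (hM _ (List.get_mem M j)).2
            frontier_eq := ?_
            index_eq_one := fun z hz => ?_
            index_eq_zero := fun z hz => ?_ }, fun z hz => ?_, fun g hg => ?_⟩
  · rw [hopen.frontier_eq]
    have : (⋃ j : Fin M.length, M.get j '' Icc 0 1) = Γ := by
      rw [← hMΓ]
      ext z
      simp only [mem_iUnion, exists_prop, List.mem_iff_get, exists_exists_eq_and]
    rw [this]
    exact Subset.antisymm (fun z hz => by_contra fun hzΓ => hz.2 ⟨hsub hz.1, hzΓ⟩)
      fun z hz => ⟨hΓcl hz, fun hz' => hz'.2 hz⟩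
  · rw [hsum _ (hcont z hz.2), hidx₁ z hz, inv_mul_cancel₀ Complex.two_pi_I_ne_zero]
  · have hzΓ : z ∉ Γ := fun h' => hz (hΓcl h')
    rw [hsum _ (hcont z hzΓ), hidx₀ z (fun h' => hz (subset_closure ⟨h', hzΓ⟩)), mul_zero]
  · have hzS : ∀ s, z ∈ latticeSquare h s → s ∈ S := fun s hs => hmemS.2 ⟨z, hs, hz⟩
    obtain ⟨s, hs⟩ := exists_mem_latticeSquare hh z
    exact ⟨mem_biUnion (hzS s hs) hs, notMem_boundaryTrace hh hzS⟩
  · have hgQ : DifferentiableOn ℂ g Q := hg.mono (iUnion₂_subset hQW)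
    rw [hsum g (hgQ.continuousOn.mono hΓQ), sum_boundaryEdges_contourIntegral]
    exact Finset.sum_eq_zero fun s hs => rectIntegral_eq_zero (by nlinarith) (by nlinarith)
      (hg.mono (hQW s hs))

/-! ### Integrals over the boundary of a Cauchy domain -/

namespace CauchyDomain

variable {U U' : Set ℂ} {B : Type*} [NormedAddCommGroup B] [NormedSpace ℂ B]

/-- The integral over the boundary of a Cauchy domain. -/
def boundaryIntegral (Δ : CauchyDomain U) (g : ℂ → B) : B :=
  ∑ j, contourIntegral (Δ.curve j) g

theorem image_curve_subset (Δ : CauchyDomain U) (j : Fin Δ.n) :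
    Δ.curve j '' Icc 0 1 ⊆ frontier Δ.carrier := by
  rw [Δ.frontier_eq]
  exact subset_iUnion (fun j => Δ.curve j '' Icc 0 1) j

theorem isCompact_closure (Δ : CauchyDomain U) : IsCompact (closure Δ.carrier) :=
  Δ.isBounded.isCompact_closure

theorem isCompact_frontier (Δ : CauchyDomain U) : IsCompact (frontier Δ.carrier) :=
  Δ.isCompact_closure.of_isClosed_subset isClosed_frontier frontier_subset_closure

theorem ne_of_mem_frontier (Δ : CauchyDomain U) {z w : ℂ} (hz : z ∈ Δ.carrier)
    (hw : w ∈ frontier Δ.carrier) : w ≠ z := by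
  rintro rfl
  rw [Δ.isOpen.frontier_eq] at hw
  exact hw.2 hz

theorem boundaryIntegral_congr (Δ : CauchyDomain U) {g g' : ℂ → B}
    (h : EqOn g g' (frontier Δ.carrier)) : Δ.boundaryIntegral g = Δ.boundaryIntegral g' :=
  Finset.sum_congr rfl fun j _ => contourIntegral_congr (h.mono (Δ.image_curve_subset j))

theorem boundaryIntegral_add (Δ : CauchyDomain U) {g g' : ℂ → B}
    (hg : ContinuousOn g (frontier Δ.carrier)) (hg' : ContinuousOn g' (frontier Δ.carrier)) :
    Δ.boundaryIntegral (fun z => g z + g' z) = Δ.boundaryIntegral g + Δ.boundaryIntegral g' := by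
  rw [boundaryIntegral, boundaryIntegral, boundaryIntegral, ← Finset.sum_add_distrib]
  exact Finset.sum_congr rfl fun j _ => contourIntegral_add (Δ.piecewiseC1 j)
    (hg.mono (Δ.image_curve_subset j)) (hg'.mono (Δ.image_curve_subset j))

theorem boundaryIntegral_sub (Δ : CauchyDomain U) {g g' : ℂ → B}
    (hg : ContinuousOn g (frontier Δ.carrier)) (hg' : ContinuousOn g' (frontier Δ.carrier)) :
    Δ.boundaryIntegral (fun z => g z - g' z) = Δ.boundaryIntegral g - Δ.boundaryIntegral g' := by
  rw [boundaryIntegral, boundaryIntegral, boundaryIntegral, ← Finset.sum_sub_distrib]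
  exact Finset.sum_congr rfl fun j _ => contourIntegral_sub (Δ.piecewiseC1 j)
    (hg.mono (Δ.image_curve_subset j)) (hg'.mono (Δ.image_curve_subset j))

theorem boundaryIntegral_smul (Δ : CauchyDomain U) (c : ℂ) (g : ℂ → B) :
    Δ.boundaryIntegral (fun z => c • g z) = c • Δ.boundaryIntegral g := by
  simp only [boundaryIntegral, contourIntegral_smul, Finset.smul_sum]

theorem boundaryIntegral_smul_const [CompleteSpace B] (Δ : CauchyDomain U) (g : ℂ → ℂ) (b : B) :
    Δ.boundaryIntegral (fun z => g z • b) = Δ.boundaryIntegral g • b := by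
  simp only [boundaryIntegral, contourIntegral_smul_const, Finset.sum_smul]

theorem boundaryIntegral_comp [CompleteSpace B] {B' : Type*} [NormedAddCommGroup B']
    [NormedSpace ℂ B'] [CompleteSpace B'] (Δ : CauchyDomain U) (l : B →L[ℂ] B') {g : ℂ → B}
    (hg : ContinuousOn g (frontier Δ.carrier)) :
    Δ.boundaryIntegral (fun z => l (g z)) = l (Δ.boundaryIntegral g) := by
  rw [boundaryIntegral, boundaryIntegral, map_sum]
  exact Finset.sum_congr rfl fun j _ => l.contourIntegral_comp (Δ.piecewiseC1 j)
    (hg.mono (Δ.image_curve_subset j))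

theorem continuousOn_inv_sub (Δ : CauchyDomain U) {z : ℂ} (hz : z ∉ frontier Δ.carrier) :
    ContinuousOn (fun w => (w - z)⁻¹) (frontier Δ.carrier) :=
  ContinuousOn.inv₀ (by fun_prop) fun w hw h0 => hz (sub_eq_zero.1 h0 ▸ hw)

theorem boundaryIntegral_sub_inv_of_mem (Δ : CauchyDomain U) {z : ℂ} (hz : z ∈ Δ.carrier) :
    Δ.boundaryIntegral (fun w => (w - z)⁻¹) = 2 * Real.pi * Complex.I :=
  ((inv_mul_eq_one₀ Complex.two_pi_I_ne_zero).1 (Δ.index_eq_one z hz)).symm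

theorem boundaryIntegral_sub_inv_of_notMem (Δ : CauchyDomain U) {z : ℂ}
    (hz : z ∉ closure Δ.carrier) : Δ.boundaryIntegral (fun w => (w - z)⁻¹) = 0 :=
  (mul_eq_zero.1 (Δ.index_eq_zero z hz)).resolve_left (inv_ne_zero Complex.two_pi_I_ne_zero)

theorem boundaryIntegral_swap (Δ : CauchyDomain U) (Δ' : CauchyDomain U') {G : ℂ → ℂ → B}
    (hG : ContinuousOn (Function.uncurry G) (frontier Δ.carrier ×ˢ frontier Δ'.carrier)) :
    Δ.boundaryIntegral (fun z => Δ'.boundaryIntegral (G z)) =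
      Δ'.boundaryIntegral (fun w => Δ.boundaryIntegral (fun z => G z w)) :=
  sum_contourIntegral_swap Δ.isCompact_frontier Δ'.isCompact_frontier Δ.piecewiseC1 Δ'.piecewiseC1
    Δ.image_curve_subset Δ'.image_curve_subset hG

theorem continuousOn_boundaryIntegral (Δ : CauchyDomain U) {K : Set ℂ} (hK : IsCompact K)
    {G : ℂ → ℂ → B} (hG : ContinuousOn (Function.uncurry G) (K ×ˢ frontier Δ.carrier)) :
    ContinuousOn (fun z => Δ.boundaryIntegral (G z)) K :=
  continuousOn_finsetSum _ fun j _ => continuousOn_contourIntegral (Δ.piecewiseC1 j) hK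
    (hG.mono (prod_mono_right (Δ.image_curve_subset j)))

/-- Integration of the difference quotient. -/
theorem boundaryIntegral_sub_inv_smul [CompleteSpace B] (Δ : CauchyDomain U) {f : ℂ → B} {z : ℂ}
    (hz : z ∈ Δ.carrier) (hf : ContinuousOn f (frontier Δ.carrier))
    (h : Δ.boundaryIntegral (dslope f z) = 0) :
    Δ.boundaryIntegral (fun w => (w - z)⁻¹ • f w) = (2 * Real.pi * Complex.I : ℂ) • f z := by
  have hz' : z ∉ frontier Δ.carrier := fun h => Δ.ne_of_mem_frontier hz h rfl
  have hc := Δ.continuousOn_inv_sub hz'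
  have e : EqOn (dslope f z) (fun w => (w - z)⁻¹ • f w - (w - z)⁻¹ • f z)
      (frontier Δ.carrier) := by
    intro w hw
    rw [dslope_of_ne _ (Δ.ne_of_mem_frontier hz hw), slope_def_module, smul_sub]
  rw [Δ.boundaryIntegral_congr e, Δ.boundaryIntegral_sub (ContinuousOn.fun_smul hc hf)
    (ContinuousOn.fun_smul hc continuousOn_const), boundaryIntegral_smul_const,
    Δ.boundaryIntegral_sub_inv_of_mem hz, sub_eq_zero] at h
  exact h

end CauchyDomain

/-! ### Cauchy's theorem -/

section Cauchy

variable {ι ι' : Type*} [Fintype ι] [Fintype ι'] {γ : ι → ℝ → ℂ} {γ' : ι' → ℝ → ℂ} {K W : Set ℂ}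

/-- The integral of a holomorphic function over a family of curves is the integral of its product
with the index over an auxiliary boundary. -/
theorem sum_contourIntegral_eq_boundaryIntegral {D : CauchyDomain W} (hW : IsOpen W)
    (hK : IsCompact K) (hKD : K ⊆ D.carrier)
    (hD : ∀ g : ℂ → ℂ, DifferentiableOn ℂ g W → D.boundaryIntegral g = 0)
    (hγ : ∀ i, IsPiecewiseC1 (γ i)) (hγK : ∀ i, γ i '' Icc 0 1 ⊆ K) {f : ℂ → ℂ}
    (hf : DifferentiableOn ℂ f W) :
    (2 * Real.pi * Complex.I) * ∑ i, contourIntegral (γ i) f =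
      D.boundaryIntegral (fun w => f w * -∑ i, contourIntegral (γ i) (fun z => (z - w)⁻¹)) := by
  have hDW : frontier D.carrier ⊆ W := frontier_subset_closure.trans D.closure_subset
  have hKW : K ⊆ W := hKD.trans (subset_closure.trans D.closure_subset)
  have hfD := hf.continuousOn.mono hDW
  -- This is Cauchy's formula for `D`: the difference quotient at `z` extends holomorphically across
  -- `z`, so its boundary integral vanishes.
  have hform : ∀ z ∈ K, D.boundaryIntegral (fun w => (w - z)⁻¹ * f w) =
      (2 * Real.pi * Complex.I) * f z := fun z hz =>
    D.boundaryIntegral_sub_inv_smul (hKD hz) hfD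
      (hD _ ((Complex.differentiableOn_dslope (hW.mem_nhds (hKW hz))).2 hf))
  have hG : ContinuousOn (Function.uncurry fun z w => (w - z)⁻¹ * f w)
      (K ×ˢ frontier D.carrier) := by
    refine ContinuousOn.mul (ContinuousOn.inv₀ (by fun_prop) ?_)
      (hfD.comp continuousOn_snd fun p hp => hp.2)
    rintro ⟨z, w⟩ ⟨hz, hw⟩
    exact sub_ne_zero.2 (D.ne_of_mem_frontier (hKD hz) hw)
  have hleft : (2 * Real.pi * Complex.I) * ∑ i, contourIntegral (γ i) f =
      ∑ i, contourIntegral (γ i) (fun z => D.boundaryIntegral (fun w => (w - z)⁻¹ * f w)) := by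
    rw [Finset.mul_sum]
    refine Finset.sum_congr rfl fun i _ => ?_
    rw [← smul_eq_mul, ← contourIntegral_smul]
    exact contourIntegral_congr fun z hz => (hform z (hγK i hz)).symm
  rw [hleft]
  refine (sum_contourIntegral_swap hK D.isCompact_frontier hγ D.piecewiseC1 hγK
    D.image_curve_subset hG).trans (D.boundaryIntegral_congr fun w _ => ?_)
  rw [mul_neg, ← neg_mul, Finset.mul_sum]
  refine Finset.sum_congr rfl fun i _ => ?_
  rw [← smul_eq_mul, ← contourIntegral_smul]
  refine contourIntegral_congr fun z _ => ?_
  simp only [smul_eq_mul]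
  rw [← neg_sub w z, inv_neg]
  ring

/-- **Cauchy's theorem**: two families of curves in a compact subset `K` of an open set `W` with
the same index about every point outside `K` give the same integrals of every holomorphic function
on `W`. -/
theorem sum_contourIntegral_eq_of_index_eq {B : Type*} [NormedAddCommGroup B] [NormedSpace ℂ B]
    [CompleteSpace B] (hW : IsOpen W) (hK : IsCompact K) (hKW : K ⊆ W)
    (hγ : ∀ i, IsPiecewiseC1 (γ i)) (hγK : ∀ i, γ i '' Icc 0 1 ⊆ K)
    (hγ' : ∀ i, IsPiecewiseC1 (γ' i)) (hγK' : ∀ i, γ' i '' Icc 0 1 ⊆ K)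
    (hind : ∀ w ∉ K, ∑ i, contourIntegral (γ i) (fun z => (z - w)⁻¹) =
      ∑ i, contourIntegral (γ' i) (fun z => (z - w)⁻¹)) {f : ℂ → B}
    (hf : DifferentiableOn ℂ f W) :
    ∑ i, contourIntegral (γ i) f = ∑ i, contourIntegral (γ' i) f := by
  obtain ⟨D, hKD, hD⟩ := exists_cauchyDomain hK hW hKW
  have key : ∀ g : ℂ → ℂ, DifferentiableOn ℂ g W →
      ∑ i, contourIntegral (γ i) g = ∑ i, contourIntegral (γ' i) g := by
    intro g hg
    refine mul_left_cancel₀ Complex.two_pi_I_ne_zero ?_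
    rw [sum_contourIntegral_eq_boundaryIntegral hW hK hKD hD hγ hγK hg,
      sum_contourIntegral_eq_boundaryIntegral hW hK hKD hD hγ' hγK' hg]
    -- The boundary of `D` avoids `K`, so the indices agree along it.
    refine D.boundaryIntegral_congr fun w hw => ?_
    rw [hind w fun hwK => D.ne_of_mem_frontier (hKD hwK) hw rfl]
  have hfK := hf.continuousOn.mono hKW
  -- Continuous linear functionals separate points, which reduces vector values to the scalar case.
  refine (SeparatingDual.eq_iff_forall_dual_eq (R := ℂ)).2 fun l => ?_
  rw [map_sum, map_sum, ← Finset.sum_congr rfl fun i _ =>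
    l.contourIntegral_comp (hγ i) (hfK.mono (hγK i)), ← Finset.sum_congr rfl fun i _ =>
    l.contourIntegral_comp (hγ' i) (hfK.mono (hγK' i))]
  exact key _ (l.differentiable.comp_differentiableOn hf)

end Cauchy

namespace CauchyDomain

variable {U U' W : Set ℂ} {B : Type*} [NormedAddCommGroup B] [NormedSpace ℂ B] [CompleteSpace B]

/-- The boundary integral does not change when the domain is deformed inside the domain of
holomorphy of the integrand. -/
theorem boundaryIntegral_eq (Δ : CauchyDomain U) (Δ' : CauchyDomain U') (hW : IsOpen W)
    (h : (closure Δ.carrier ∪ closure Δ'.carrier) \ (Δ.carrier ∩ Δ'.carrier) ⊆ W) {f : ℂ → B}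
    (hf : DifferentiableOn ℂ f W) : Δ.boundaryIntegral f = Δ'.boundaryIntegral f := by
  -- The compact set is the union of the closures minus the intersection of the domains; it contains
  -- both boundaries. A point outside it lies in both domains, with index one for each, or outside
  -- both closures, with index zero.
  refine sum_contourIntegral_eq_of_index_eq hW
    ((Δ.isCompact_closure.union Δ'.isCompact_closure).diff (Δ.isOpen.inter Δ'.isOpen)) h
    Δ.piecewiseC1 (fun j z hz => ?_) Δ'.piecewiseC1 (fun j z hz => ?_) (fun w hw => ?_) hf
  · have hz' := Δ.image_curve_subset j hz
    exact ⟨Or.inl (frontier_subset_closure hz'), fun h' => Δ.ne_of_mem_frontier h'.1 hz' rfl⟩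
  · have hz' := Δ'.image_curve_subset j hz
    exact ⟨Or.inr (frontier_subset_closure hz'), fun h' => Δ'.ne_of_mem_frontier h'.2 hz' rfl⟩
  · by_cases hw' : w ∈ Δ.carrier ∩ Δ'.carrier
    · exact (Δ.boundaryIntegral_sub_inv_of_mem hw'.1).trans
        (Δ'.boundaryIntegral_sub_inv_of_mem hw'.2).symm
    · have hw₁ : w ∉ closure Δ.carrier ∪ closure Δ'.carrier := fun h' => hw ⟨h', hw'⟩
      rw [mem_union, not_or] at hw₁
      exact (Δ.boundaryIntegral_sub_inv_of_notMem hw₁.1).trans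
        (Δ'.boundaryIntegral_sub_inv_of_notMem hw₁.2).symm

theorem boundaryIntegral_eq_zero (Δ : CauchyDomain U) (hW : IsOpen W)
    (h : closure Δ.carrier ⊆ W) {f : ℂ → B} (hf : DifferentiableOn ℂ f W) :
    Δ.boundaryIntegral f = 0 := by
  -- The comparison is with the empty family of curves, which has index zero everywhere.
  refine (sum_contourIntegral_eq_of_index_eq (γ' := (Fin.elim0 : Fin 0 → ℝ → ℂ)) hW
    Δ.isCompact_closure h Δ.piecewiseC1
    (fun j => (Δ.image_curve_subset j).trans frontier_subset_closure) (fun j => j.elim0)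
    (fun j => j.elim0) (fun w hw => ?_) hf).trans (Finset.sum_empty)
  exact (Δ.boundaryIntegral_sub_inv_of_notMem hw).trans Finset.sum_empty.symm

/-- Cauchy's integral formula. -/
theorem boundaryIntegral_sub_inv_smul_of_mem (Δ : CauchyDomain U) (hU : IsOpen U) {f : ℂ → B}
    (hf : DifferentiableOn ℂ f U) {z : ℂ} (hz : z ∈ Δ.carrier) :
    Δ.boundaryIntegral (fun w => (w - z)⁻¹ • f w) = (2 * Real.pi * Complex.I : ℂ) • f z :=
  Δ.boundaryIntegral_sub_inv_smul hz
    (hf.continuousOn.mono (frontier_subset_closure.trans Δ.closure_subset))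
    (Δ.boundaryIntegral_eq_zero hU Δ.closure_subset ((Complex.differentiableOn_dslope
      (hU.mem_nhds (Δ.closure_subset (subset_closure hz)))).2 hf))

theorem boundaryIntegral_sub_inv_smul_of_notMem (Δ : CauchyDomain U) (hU : IsOpen U) {f : ℂ → B}
    (hf : DifferentiableOn ℂ f U) {z : ℂ} (hz : z ∉ closure Δ.carrier) :
    Δ.boundaryIntegral (fun w => (w - z)⁻¹ • f w) = 0 := by
  refine Δ.boundaryIntegral_eq_zero (hU.inter (isOpen_compl_singleton (x := z)))
    (fun w hw => ⟨Δ.closure_subset hw, ?_⟩) ?_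
  · rintro rfl
    exact hz hw
  · refine DifferentiableOn.smul (fun w hw => ?_) (hf.mono inter_subset_left)
    exact ((differentiableAt_id.sub_const z).inv (sub_ne_zero.2 hw.2)).differentiableWithinAt

end CauchyDomain

/-! ### Discs -/

section Disc

variable {B : Type*} [NormedAddCommGroup B] [NormedSpace ℂ B]

/-- The circle of radius `r` about the origin, parametrized by `[0, 1]`. -/
def circleCurve (r : ℝ) : ℝ → ℂ := fun t => circleMap 0 r (2 * Real.pi * t)

theorem contourIntegral_circleCurve (r : ℝ) (g : ℂ → B) :
    contourIntegral (circleCurve r) g = ∮ z in C(0, r), g z := by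
  have h := intervalIntegral.smul_integral_comp_mul_left (a := 0) (b := 1)
    (fun t : ℝ => deriv (circleMap 0 r) t • g (circleMap 0 r t)) (2 * Real.pi)
  rw [mul_zero, mul_one, ← intervalIntegral.integral_smul] at h
  rw [circleIntegral, ← h, contourIntegral]
  refine intervalIntegral.integral_congr fun t _ => ?_
  have hd : deriv (circleCurve r) t = (2 * Real.pi) • deriv (circleMap 0 r) (2 * Real.pi * t) :=
    deriv_comp_mul_left _ _ _
  simp only [hd, circleCurve, smul_assoc]

theorem image_circleCurve {r : ℝ} (hr : 0 < r) :
    circleCurve r '' Icc 0 1 = Metric.sphere 0 r := by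
  refine Subset.antisymm ?_ fun z hz => ?_
  · rintro _ ⟨t, _, rfl⟩
    exact circleMap_mem_sphere 0 hr.le _
  · rw [← abs_of_pos hr, ← image_circleMap_Ioc] at hz
    obtain ⟨t, ht, rfl⟩ := hz
    refine ⟨t / (2 * Real.pi), ⟨by have := ht.1; positivity, ?_⟩, ?_⟩
    · rw [div_le_one (by positivity)]
      exact ht.2
    · simp only [circleCurve]
      rw [mul_div_cancel₀ _ (by positivity)]

/-- The disc of radius `r` about the origin. -/
def discCauchyDomain {r : ℝ} (hr : 0 < r) : CauchyDomain univ where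
  carrier := Metric.ball 0 r
  isOpen := Metric.isOpen_ball
  isBounded := Metric.isBounded_ball
  closure_subset := subset_univ _
  n := 1
  curve := fun _ => circleCurve r
  piecewiseC1 := fun _ => by
    refine ⟨1, fun i => i, Nat.mono_cast, by simp, by simp, fun i _ => ?_⟩
    exact ((contDiff_circleMap 0 r).comp (contDiff_const.mul contDiff_id)).contDiffOn
  closed := fun _ => by simp [circleCurve, circleMap]
  frontier_eq := by
    rw [iUnion_const, image_circleCurve hr, frontier_ball 0 hr.ne']
  index_eq_one := fun z hz => by
    rw [Fin.sum_univ_one, contourIntegral_circleCurve, circleIntegral.integral_sub_inv_of_mem_ball hz,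
      inv_mul_cancel₀ Complex.two_pi_I_ne_zero]
  index_eq_zero := fun z hz => by
    rw [closure_ball 0 hr.ne'] at hz
    rw [Fin.sum_univ_one, contourIntegral_circleCurve, DiffContOnCl.circleIntegral_eq_zero hr.le,
      mul_zero]
    refine DifferentiableOn.diffContOnCl_ball (U := {z}ᶜ) (fun w hw => ?_) fun w hw => ?_
    · exact ((differentiableAt_id.sub_const z).inv (sub_ne_zero.2 hw)).differentiableWithinAt
    · rintro rfl
      exact hz hw

end Disc

/-! ### The Riesz-Dunford calculus in a complex Banach algebra -/

section Resolvent

variable {B : Type*} [Ring B] [Algebra ℂ B] {a : B} {z w : ℂ}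

theorem sub_mul_resolvent (hz : z ∉ spectrum ℂ a) :
    (algebraMap ℂ B z - a) * resolvent a z = 1 :=
  Ring.mul_inverse_cancel _ (spectrum.notMem_iff.1 hz)

theorem resolvent_mul_sub (hz : z ∉ spectrum ℂ a) :
    resolvent a z * (algebraMap ℂ B z - a) = 1 :=
  Ring.inverse_mul_cancel _ (spectrum.notMem_iff.1 hz)

/-- The resolvent identity. -/
theorem resolvent_mul_resolvent (hz : z ∉ spectrum ℂ a) (hw : w ∉ spectrum ℂ a) (hzw : w ≠ z) :
    resolvent a z * resolvent a w = (w - z)⁻¹ • (resolvent a z - resolvent a w) := by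
  have h : resolvent a z - resolvent a w = (w - z) • (resolvent a z * resolvent a w) := by
    calc resolvent a z - resolvent a w
        = resolvent a z * ((algebraMap ℂ B w - a) * resolvent a w) -
            (resolvent a z * (algebraMap ℂ B z - a)) * resolvent a w := by
          rw [sub_mul_resolvent hw, resolvent_mul_sub hz, mul_one, one_mul]
      _ = resolvent a z * ((algebraMap ℂ B w - algebraMap ℂ B z) * resolvent a w) := by
          noncomm_ring
      _ = (w - z) • (resolvent a z * resolvent a w) := by
          rw [← map_sub, ← Algebra.smul_def, mul_smul_comm]
  rw [h, inv_smul_smul₀ (sub_ne_zero.2 hzw)]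

end Resolvent

section Dunford

variable {U U' W : Set ℂ} {B : Type*} [NormedRing B] [NormedAlgebra ℂ B]

/-- The Riesz-Dunford integral in a complex Banach algebra. -/
def dunford (Δ : CauchyDomain U) (F : ℂ → B) (a : B) : B :=
  (2 * Real.pi * Complex.I : ℂ)⁻¹ • Δ.boundaryIntegral (fun z => F z * resolvent a z)

theorem frontier_subset_compl_spectrum {a : B} {Δ : CauchyDomain U}
    (ha : spectrum ℂ a ⊆ Δ.carrier) : frontier Δ.carrier ⊆ (spectrum ℂ a)ᶜ :=
  fun _ hz hz' => Δ.ne_of_mem_frontier (ha hz') hz rfl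

theorem dunford_congr {a : B} {Δ : CauchyDomain U} {F G : ℂ → B}
    (h : EqOn F G (frontier Δ.carrier)) : dunford Δ F a = dunford Δ G a := by
  rw [dunford, dunford, Δ.boundaryIntegral_congr fun z hz => by rw [h hz]]

theorem dunford_disc {r : ℝ} (hr : 0 < r) (a : B) (F : ℂ → B) :
    dunford (discCauchyDomain hr) F a =
      (2 * Real.pi * Complex.I : ℂ)⁻¹ • ∮ z in C(0, r), F z * resolvent a z := by
  rw [dunford, ← contourIntegral_circleCurve]
  congr 1
  exact Fin.sum_univ_one _

variable [CompleteSpace B]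

theorem differentiableOn_resolvent (a : B) :
    DifferentiableOn ℂ (resolvent a) (spectrum ℂ a)ᶜ := fun _ hz =>
  (spectrum.hasDerivAt_resolvent_const_left
    (spectrum.notMem_iff.1 hz)).differentiableAt.differentiableWithinAt

theorem continuousOn_resolvent_frontier {a : B} {Δ : CauchyDomain U}
    (ha : spectrum ℂ a ⊆ Δ.carrier) : ContinuousOn (resolvent a) (frontier Δ.carrier) :=
  (differentiableOn_resolvent a).continuousOn.mono (frontier_subset_compl_spectrum ha)

theorem dunford_add {a : B} {Δ : CauchyDomain U} (ha : spectrum ℂ a ⊆ Δ.carrier) {F G : ℂ → B}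
    (hF : ContinuousOn F (frontier Δ.carrier)) (hG : ContinuousOn G (frontier Δ.carrier)) :
    dunford Δ (fun z => F z + G z) a = dunford Δ F a + dunford Δ G a := by
  have hR := continuousOn_resolvent_frontier ha
  simp only [dunford, add_mul]
  rw [Δ.boundaryIntegral_add (ContinuousOn.fun_mul hF hR) (ContinuousOn.fun_mul hG hR), smul_add]

theorem dunford_const_mul {a : B} {Δ : CauchyDomain U} (ha : spectrum ℂ a ⊆ Δ.carrier) (b : B)
    {F : ℂ → B} (hF : ContinuousOn F (frontier Δ.carrier)) :
    dunford Δ (fun z => b * F z) a = b * dunford Δ F a := by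
  have hR := continuousOn_resolvent_frontier ha
  simp only [dunford, mul_assoc]
  rw [mul_smul_comm, ← ContinuousLinearMap.mul_apply' ℂ B b (Δ.boundaryIntegral _),
    ← Δ.boundaryIntegral_comp _ (ContinuousOn.fun_mul hF hR)]
  rfl

/-- The Riesz-Dunford integral does not depend on the Cauchy domain. -/
theorem dunford_eq {a : B} {Δ : CauchyDomain U} {Δ' : CauchyDomain U'}
    (ha : spectrum ℂ a ⊆ Δ.carrier) (ha' : spectrum ℂ a ⊆ Δ'.carrier) (hW : IsOpen W)
    (h : closure Δ.carrier ⊆ W) (h' : closure Δ'.carrier ⊆ W) {F : ℂ → B}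
    (hF : DifferentiableOn ℂ F W) : dunford Δ F a = dunford Δ' F a := by
  -- The integrand is holomorphic on `W` minus the spectrum, and the spectrum lies in both domains,
  -- hence outside the region between the boundaries.
  rw [dunford, dunford, Δ.boundaryIntegral_eq Δ'
    (hW.inter (spectrum.isClosed (𝕜 := ℂ) a).isOpen_compl)]
  · rintro z ⟨hz, hz'⟩
    exact ⟨hz.elim (fun hz => h hz) fun hz => h' hz, fun hza => hz' ⟨ha hza, ha' hza⟩⟩
  · exact (hF.mono inter_subset_left).mul
      ((differentiableOn_resolvent a).mono inter_subset_right)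

/-- Write the product as a double integral with `z` on the inner and `w` on the outer boundary.
Because `f w` is scalar, it moves past the resolvent at `z`, and the resolvent identity splits the
integrand. The part with the resolvent at `z` is evaluated by Cauchy's formula for `f` over the
outer boundary. The part with the resolvent at `w` vanishes on integrating first in `z`, since `w`
lies outside the closure of the inner domain. -/
theorem dunford_mul_algebraMap_of_closure_subset (hU : IsOpen U) {a : B} {Δ Δ' : CauchyDomain U}
    (ha : spectrum ℂ a ⊆ Δ.carrier) (hΔ : closure Δ.carrier ⊆ Δ'.carrier) {F : ℂ → B}
    (hF : DifferentiableOn ℂ F U) {f : ℂ → ℂ} (hf : DifferentiableOn ℂ f U) :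
    dunford Δ (fun z => F z * algebraMap ℂ B (f z)) a =
      dunford Δ F a * dunford Δ' (fun z => algebraMap ℂ B (f z)) a := by
  have ha' : spectrum ℂ a ⊆ Δ'.carrier := ha.trans (subset_closure.trans hΔ)
  have hR := continuousOn_resolvent_frontier ha
  have hR' := continuousOn_resolvent_frontier ha'
  have hFc := hF.continuousOn.mono (frontier_subset_closure.trans Δ.closure_subset)
  have hfc := hf.continuousOn.mono (frontier_subset_closure.trans Δ.closure_subset)
  have hfc' := hf.continuousOn.mono (frontier_subset_closure.trans Δ'.closure_subset)
  have hin : ∀ z ∈ frontier Δ.carrier, z ∈ Δ'.carrier := fun z hz =>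
    hΔ (frontier_subset_closure hz)
  have hinv : ContinuousOn (fun p : ℂ × ℂ => (p.2 - p.1)⁻¹)
      (frontier Δ.carrier ×ˢ frontier Δ'.carrier) :=
    ContinuousOn.inv₀ (by fun_prop) fun p hp =>
      sub_ne_zero.2 (Δ'.ne_of_mem_frontier (hin _ hp.1) hp.2)
  have hfst : MapsTo (Prod.fst : ℂ × ℂ → ℂ) (frontier Δ.carrier ×ˢ frontier Δ'.carrier)
    (frontier Δ.carrier) := fun p hp => hp.1
  have hsnd : MapsTo (Prod.snd : ℂ × ℂ → ℂ) (frontier Δ.carrier ×ˢ frontier Δ'.carrier)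
    (frontier Δ'.carrier) := fun p hp => hp.2
  set G : ℂ → ℂ → B := fun z w => ((w - z)⁻¹ * f w) • (F z * resolvent a w) with hG
  have hGc : ContinuousOn (Function.uncurry G) (frontier Δ.carrier ×ˢ frontier Δ'.carrier) :=
    (hinv.mul (hfc'.comp continuousOn_snd hsnd)).smul
      ((hFc.comp continuousOn_fst hfst).mul (hR'.comp continuousOn_snd hsnd))
  have hzero : Δ.boundaryIntegral (fun z => Δ'.boundaryIntegral (G z)) = 0 := by
    rw [Δ.boundaryIntegral_swap Δ' hGc]
    refine (Δ'.boundaryIntegral_congr (g' := fun _ => (0 : ℂ) • (0 : B)) fun w hw => ?_).trans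
      (by rw [Δ'.boundaryIntegral_smul, zero_smul])
    have hw' : w ∉ closure Δ.carrier := fun h => Δ'.ne_of_mem_frontier (hΔ h) hw rfl
    have hc := Δ.continuousOn_inv_sub fun h => hw' (frontier_subset_closure h)
    have e : (fun z => G z w) = fun z => ((ContinuousLinearMap.mul ℂ B).flip
        (-f w • resolvent a w)) ((z - w)⁻¹ • F z) := by
      funext z
      simp only [hG, ContinuousLinearMap.flip_apply, ContinuousLinearMap.mul_apply',
        mul_smul_comm, smul_mul_assoc, smul_smul]
      congr 1
      rw [← neg_sub w z, inv_neg]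
      ring
    beta_reduce
    rw [e, Δ.boundaryIntegral_comp _ (ContinuousOn.fun_smul hc hFc),
      Δ.boundaryIntegral_sub_inv_smul_of_notMem hU hF hw', map_zero, smul_zero]
  have hinner : ∀ z ∈ frontier Δ.carrier, F z * resolvent a z *
      Δ'.boundaryIntegral (fun w => algebraMap ℂ B (f w) * resolvent a w) =
      (2 * Real.pi * Complex.I : ℂ) • (F z * algebraMap ℂ B (f z) * resolvent a z) -
        Δ'.boundaryIntegral (G z) := by
    intro z hz
    have hz' : z ∉ frontier Δ'.carrier := fun h => Δ'.ne_of_mem_frontier (hin z hz) h rfl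
    have hc := Δ'.continuousOn_inv_sub hz'
    have hGz : ContinuousOn (G z) (frontier Δ'.carrier) :=
      hGc.comp (f := fun w => (z, w)) (by fun_prop) fun w hw => ⟨hz, hw⟩
    have e₁ : Δ'.boundaryIntegral (fun w => ((w - z)⁻¹ * f w) • (F z * resolvent a z)) =
        (2 * Real.pi * Complex.I : ℂ) • (F z * algebraMap ℂ B (f z) * resolvent a z) := by
      rw [Δ'.boundaryIntegral_smul_const]
      have := Δ'.boundaryIntegral_sub_inv_smul_of_mem hU hf (hin z hz)
      simp only [smul_eq_mul] at this
      rw [this, mul_smul, ← Algebra.commutes, ← Algebra.smul_def, smul_mul_assoc]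
    rw [← e₁, ← Δ'.boundaryIntegral_sub
      (ContinuousOn.fun_smul (ContinuousOn.fun_mul hc hfc') continuousOn_const) hGz,
      ← ContinuousLinearMap.mul_apply' ℂ B _ (Δ'.boundaryIntegral _),
      ← Δ'.boundaryIntegral_comp]
    · refine Δ'.boundaryIntegral_congr fun w hw => ?_
      simp only [hG, ContinuousLinearMap.mul_apply', ← smul_sub, ← mul_sub]
      rw [← Algebra.smul_def, mul_smul_comm, mul_assoc, resolvent_mul_resolvent
        (frontier_subset_compl_spectrum ha hz) (frontier_subset_compl_spectrum ha' hw)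
        (Δ'.ne_of_mem_frontier (hin z hz) hw), mul_smul_comm, smul_smul, mul_comm]
    · simp only [← Algebra.smul_def]
      exact ContinuousOn.fun_smul hfc' hR'
  have hmain : Δ.boundaryIntegral (fun z => F z * resolvent a z) *
      Δ'.boundaryIntegral (fun w => algebraMap ℂ B (f w) * resolvent a w) =
      (2 * Real.pi * Complex.I : ℂ) •
        Δ.boundaryIntegral (fun z => F z * algebraMap ℂ B (f z) * resolvent a z) := by
    set b := Δ'.boundaryIntegral (fun w => algebraMap ℂ B (f w) * resolvent a w)
    have e : Δ.boundaryIntegral (fun z => F z * resolvent a z) * b =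
        Δ.boundaryIntegral (fun z => F z * resolvent a z * b) :=
      (Δ.boundaryIntegral_comp ((ContinuousLinearMap.mul ℂ B).flip b)
        (ContinuousOn.fun_mul hFc hR)).symm
    have hfB : ContinuousOn (fun z => algebraMap ℂ B (f z)) (frontier Δ.carrier) := by
      simp only [Algebra.algebraMap_eq_smul_one]
      exact ContinuousOn.fun_smul hfc continuousOn_const
    rw [e, Δ.boundaryIntegral_congr hinner, Δ.boundaryIntegral_sub, hzero, sub_zero,
      Δ.boundaryIntegral_smul]
    · exact ContinuousOn.fun_const_smul
        (ContinuousOn.fun_mul (ContinuousOn.fun_mul hFc hfB) hR) _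
    · exact Δ'.continuousOn_boundaryIntegral Δ.isCompact_frontier hGc
  rw [dunford, dunford, dunford, smul_mul_smul_comm, hmain, smul_smul,
    inv_mul_cancel_right₀ Complex.two_pi_I_ne_zero]

/-- A larger Cauchy domain around the closure of `Δ` provides the nested pair; independence of the
domain then brings the second factor back to `Δ`. -/
theorem dunford_mul_algebraMap (hU : IsOpen U) {a : B} {Δ : CauchyDomain U}
    (ha : spectrum ℂ a ⊆ Δ.carrier) {F : ℂ → B} (hF : DifferentiableOn ℂ F U) {f : ℂ → ℂ}
    (hf : DifferentiableOn ℂ f U) :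
    dunford Δ (fun z => F z * algebraMap ℂ B (f z)) a =
      dunford Δ F a * dunford Δ (fun z => algebraMap ℂ B (f z)) a := by
  obtain ⟨Δ', hΔ, -⟩ := exists_cauchyDomain Δ.isCompact_closure hU Δ.closure_subset
  have hfB : DifferentiableOn ℂ (fun z => algebraMap ℂ B (f z)) U := by
    simp only [Algebra.algebraMap_eq_smul_one]
    exact hf.smul_const 1
  rw [dunford_mul_algebraMap_of_closure_subset hU ha hΔ hF hf,
    dunford_eq (ha.trans (subset_closure.trans hΔ)) ha hU Δ'.closure_subset Δ.closure_subset hfB]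

/-- On a large circle the resolvent at `z` is `z⁻¹` plus `z⁻¹` times `a * resolvent a z`. The first
term integrates to `2πi`. Since `a * resolvent a z` tends to zero at infinity, the second
contributes at most `ε` after normalization. -/
theorem dunford_one {a : B} {Δ : CauchyDomain U} (ha : spectrum ℂ a ⊆ Δ.carrier) :
    dunford Δ (fun _ => 1) a = 1 := by
  -- The norm of the unit is kept because it is not assumed to be one.
  have hsp : ∀ z : ℂ, ‖a‖ * ‖(1 : B)‖ < ‖z‖ → z ∉ spectrum ℂ a := fun z hz =>
    spectrum.notMem_iff.2 (spectrum.mem_resolventSet_of_norm_lt_mul hz)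
  rw [← sub_eq_zero, ← norm_le_zero_iff]
  refine le_of_forall_pos_le_add fun ε hε => ?_
  rw [zero_add]
  obtain ⟨ρ, hρ⟩ : ∃ ρ : ℝ, ∀ z : ℂ, ρ ≤ ‖z‖ → ‖a * resolvent a z‖ ≤ ε := by
    have h : Tendsto (fun z : ℂ => ‖a * resolvent a z‖) (Bornology.cobounded ℂ) (𝓝 0) := by
      simpa using ((spectrum.resolvent_tendsto_cobounded (𝕜 := ℂ) a).const_mul a).norm
    have h' := h.eventually (eventually_le_nhds hε)
    rw [← comap_norm_atTop, eventually_comap] at h'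
    obtain ⟨ρ, hρ⟩ := eventually_atTop.1 h'
    exact ⟨ρ, fun z hz => hρ _ hz z rfl⟩
  obtain ⟨r, hr⟩ : ∃ r : ℝ, 0 < r ∧ ‖a‖ * ‖(1 : B)‖ < r ∧ ρ ≤ r :=
    ⟨max ρ (‖a‖ * ‖(1 : B)‖ + 1), lt_max_of_lt_right (by positivity),
      lt_max_of_lt_right (by simp), le_max_left _ _⟩
  obtain ⟨hr, hra, hrρ⟩ := hr
  have hball : spectrum ℂ a ⊆ (discCauchyDomain hr).carrier := fun z hz => by
    rw [discCauchyDomain, mem_ball_zero_iff]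
    by_contra! h
    exact hsp z (hra.trans_le h) hz
  have hcR : ContinuousOn (resolvent a) (Metric.sphere (0 : ℂ) r) :=
    (differentiableOn_resolvent a).continuousOn.mono fun z hz =>
      hsp z (by rwa [mem_sphere_zero_iff_norm.1 hz])
  have hci : ContinuousOn (fun z : ℂ => z⁻¹) (Metric.sphere (0 : ℂ) r) :=
    continuousOn_inv₀.mono fun z hz => by
      rintro rfl
      simp at hz
      exact hr.ne hz
  have e : ∮ z in C(0, r), 1 * resolvent a z =
      (∮ z in C(0, r), z⁻¹ • (1 : B)) + ∮ z in C(0, r), z⁻¹ • (a * resolvent a z) := by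
    rw [← circleIntegral.integral_add
      (ContinuousOn.circleIntegrable hr.le (ContinuousOn.fun_smul hci continuousOn_const))
      (ContinuousOn.circleIntegrable hr.le (ContinuousOn.fun_smul hci
        (ContinuousOn.fun_mul continuousOn_const hcR)))]
    refine circleIntegral.integral_congr hr.le fun z hz => ?_
    have hz0 : z ≠ 0 := by
      rintro rfl
      simp at hz
      exact hr.ne hz
    have h := sub_mul_resolvent (hsp z (by rwa [mem_sphere_zero_iff_norm.1 hz]))
    rw [sub_mul, sub_eq_iff_eq_add, ← Algebra.smul_def] at h
    simp only [one_mul, ← smul_add]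
    rw [← h, inv_smul_smul₀ hz0]
  have e₁ : ∮ z in C(0, r), z⁻¹ • (1 : B) = (2 * Real.pi * Complex.I : ℂ) • 1 := by
    rw [circleIntegral.integral_smul_const]
    have := circleIntegral.integral_sub_inv_of_mem_ball (Metric.mem_ball_self hr : (0 : ℂ) ∈ _)
    simp only [sub_zero] at this
    rw [this]
  rw [dunford_eq ha hball isOpen_univ (subset_univ _) (subset_univ _) (differentiableOn_const 1),
    dunford_disc, e, e₁, smul_add, inv_smul_smul₀ Complex.two_pi_I_ne_zero, add_sub_cancel_left]
  refine (circleIntegral.norm_two_pi_i_inv_smul_integral_le_of_norm_le_const hr.le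
    (C := r⁻¹ * ε) fun z hz => ?_).trans_eq (mul_inv_cancel_left₀ hr.ne' ε)
  rw [mem_sphere_zero_iff_norm] at hz
  rw [norm_smul, norm_inv, hz]
  gcongr
  exact hρ z (hrρ.trans_eq hz.symm)

theorem dunford_const {a : B} {Δ : CauchyDomain U} (ha : spectrum ℂ a ⊆ Δ.carrier) (b : B) :
    dunford Δ (fun _ => b) a = b := by
  have := dunford_const_mul ha b (continuousOn_const (c := 1))
  simpa only [dunford_one ha, mul_one] using this

/-- Here `z` times the resolvent equals `1 + a * resolvent a z`; the constant `1` integrates to zero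
by Cauchy's theorem, leaving the calculus of the constant `a`. -/
theorem dunford_id (hU : IsOpen U) {a : B} {Δ : CauchyDomain U} (ha : spectrum ℂ a ⊆ Δ.carrier) :
    dunford Δ (fun z => algebraMap ℂ B z) a = a := by
  have hR := continuousOn_resolvent_frontier ha
  have h1 : dunford Δ (fun _ => a) a = a := dunford_const ha a
  have e : EqOn (fun z => algebraMap ℂ B z * resolvent a z) (fun z => 1 + a * resolvent a z)
      (frontier Δ.carrier) := fun z hz => by
    have h := sub_mul_resolvent (frontier_subset_compl_spectrum ha hz)
    rwa [sub_mul, sub_eq_iff_eq_add] at h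
  rw [dunford, Δ.boundaryIntegral_congr e, Δ.boundaryIntegral_add continuousOn_const
    (ContinuousOn.fun_mul continuousOn_const hR),
    Δ.boundaryIntegral_eq_zero hU Δ.closure_subset (differentiableOn_const 1), zero_add]
  exact h1

theorem dunford_pow (hU : IsOpen U) {a : B} {Δ : CauchyDomain U} (ha : spectrum ℂ a ⊆ Δ.carrier)
    (n : ℕ) : dunford Δ (fun z => algebraMap ℂ B (z ^ n)) a = a ^ n := by
  induction n with
  | zero => simpa using dunford_one ha
  | succ n ih =>
    have h := dunford_mul_algebraMap hU ha (F := fun z => algebraMap ℂ B (z ^ n)) (f := id)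
      (by simp only [Algebra.algebraMap_eq_smul_one]; fun_prop) differentiableOn_id
    simp only [id, ih, dunford_id hU ha, ← map_mul, ← pow_succ] at h
    exact h

end Dunford

/-! ### The conjugate of a Cauchy domain -/

section Conjugate

variable {U : Set ℂ} {B : Type*} [NormedAddCommGroup B] [NormedSpace ℂ B] {γ : ℝ → ℂ}

/-- The complex conjugate of a curve, traversed backwards. -/
def conjReverse (γ : ℝ → ℂ) : ℝ → ℂ := fun t => conj (γ (1 - t))

theorem IsPiecewiseC1.conjReverse (hγ : IsPiecewiseC1 γ) : IsPiecewiseC1 (conjReverse γ) := by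
  obtain ⟨n, t, ht, h0, h1, hc⟩ := hγ
  refine ⟨n, fun i => 1 - t (n - i), fun i j h => ?_, by simp [h1], by simp [h0], fun i hi => ?_⟩
  · exact sub_le_sub_left (ht (Nat.sub_le_sub_left h n)) 1
  · refine Complex.conjCLE.contDiff.comp_contDiffOn ((hc (n - (i + 1)) (by omega)).comp
      (contDiff_const.sub contDiff_id).contDiffOn fun x hx => ?_)
    rw [show n - (i + 1) + 1 = n - i by omega]
    exact ⟨by linarith [hx.2], by linarith [hx.1]⟩

theorem image_conjReverse (γ : ℝ → ℂ) :
    conjReverse γ '' Icc 0 1 = conj ⁻¹' (γ '' Icc 0 1) := by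
  ext z
  constructor
  · rintro ⟨t, ht, rfl⟩
    exact ⟨1 - t, ⟨by linarith [ht.2], by linarith [ht.1]⟩, by simp [conjReverse]⟩
  · rintro ⟨t, ht, h⟩
    exact ⟨1 - t, ⟨by linarith [ht.2], by linarith [ht.1]⟩, by simp [conjReverse, h]⟩

/-- The derivative of the new curve at `t` is minus the conjugate of `deriv γ (1 - t)`. An abstract
conjugate-linear `c` covers both complex conjugation, for indices, and the conjugation of `A_ℂ`, for
the calculus. -/
theorem contourIntegral_conjReverse [CompleteSpace B] (hγ : IsPiecewiseC1 γ) (c : B →L[ℝ] B)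
    (hc : ∀ (z : ℂ) (b : B), c (z • b) = conj z • c b) {g : ℂ → B}
    (hg : ContinuousOn g (γ '' Icc 0 1)) :
    contourIntegral (conjReverse γ) (fun z => c (g (conj z))) = -c (contourIntegral γ g) := by
  rw [contourIntegral, contourIntegral, ← c.intervalIntegral_comp_comm (hγ.intervalIntegrable hg),
    ← intervalIntegral.integral_neg]
  have := intervalIntegral.integral_comp_sub_left (a := 0) (b := 1)
    (fun t : ℝ => -c (deriv γ t • g (γ t))) 1
  rw [sub_self, sub_zero] at this
  rw [← this]
  refine intervalIntegral.integral_congr fun t _ => ?_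
  have hd : deriv (conjReverse γ) t = -conj (deriv γ (1 - t)) := by
    have h1 : deriv (conjReverse γ) t = conj (deriv (fun t => γ (1 - t)) t) := deriv.star
    rw [h1, deriv_comp_const_sub, map_neg]
  simp only [hd, hc, neg_smul, _root_.conjReverse, Complex.conj_conj]

theorem contourIntegral_conjReverse_sub_inv (hγ : IsPiecewiseC1 γ) {z : ℂ}
    (hz : conj z ∉ γ '' Icc 0 1) :
    contourIntegral (conjReverse γ) (fun w => (w - z)⁻¹) =
      -conj (contourIntegral γ (fun w => (w - conj z)⁻¹)) := by
  rw [← Complex.conjCLE_apply, ← ContinuousLinearEquiv.coe_coe,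
    ← contourIntegral_conjReverse hγ _ (by simp)]
  · simp
  · exact ContinuousOn.inv₀ (by fun_prop) fun w hw h0 => hz (sub_eq_zero.1 h0 ▸ hw)

theorem conj_two_pi_I_inv : conj (2 * Real.pi * Complex.I)⁻¹ = -(2 * Real.pi * Complex.I)⁻¹ := by
  simp [Complex.conj_ofNat]

namespace CauchyDomain

theorem index_conjReverse (Δ : CauchyDomain U) {z : ℂ} (hz : conj z ∉ frontier Δ.carrier) :
    (2 * Real.pi * Complex.I)⁻¹ *
        ∑ j, contourIntegral (conjReverse (Δ.curve j)) (fun w => (w - z)⁻¹) =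
      conj ((2 * Real.pi * Complex.I)⁻¹ *
        ∑ j, contourIntegral (Δ.curve j) (fun w => (w - conj z)⁻¹)) := by
  rw [map_mul, conj_two_pi_I_inv, map_sum, neg_mul, ← mul_neg, ← Finset.sum_neg_distrib]
  congr 1
  exact Finset.sum_congr rfl fun j _ => contourIntegral_conjReverse_sub_inv (Δ.piecewiseC1 j)
    fun h => hz (Δ.image_curve_subset j h)

/-- The complex conjugate of a Cauchy domain. -/
def conjDomain (hU : ∀ z ∈ U, conj z ∈ U) (Δ : CauchyDomain U) : CauchyDomain U where
  carrier := conj ⁻¹' Δ.carrier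
  isOpen := Δ.isOpen.preimage Complex.continuous_conj
  isBounded := by
    have : conj ⁻¹' Δ.carrier = Complex.conjLIE '' Δ.carrier := by
      ext z
      exact ⟨fun h => ⟨conj z, h, by simp⟩, by rintro ⟨w, hw, rfl⟩; simpa using hw⟩
    rw [this]
    exact Complex.conjLIE.lipschitz.isBounded_image Δ.isBounded
  closure_subset := fun z hz => by
    rw [← Complex.conj_conj z]
    exact hU _ (Δ.closure_subset (Complex.continuous_conj.closure_preimage_subset _ hz))
  n := Δ.n
  curve := fun j => conjReverse (Δ.curve j)
  piecewiseC1 := fun j => (Δ.piecewiseC1 j).conjReverse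
  closed := fun j => by simp [conjReverse, Δ.closed j]
  frontier_eq := by
    have h := Complex.conjCLE.toHomeomorph.preimage_frontier Δ.carrier
    refine h.symm.trans ?_
    simp only [image_conjReverse, ← preimage_iUnion, ← Δ.frontier_eq]
    rfl
  index_eq_one := fun z hz => by
    rw [Δ.index_conjReverse fun h => Δ.ne_of_mem_frontier hz h rfl, Δ.index_eq_one _ hz, map_one]
  index_eq_zero := fun z hz => by
    have hz' : conj z ∉ closure Δ.carrier := by
      have h := Complex.conjCLE.toHomeomorph.preimage_closure Δ.carrier
      intro h'
      exact hz ((Set.ext_iff.1 h z).1 h')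
    rw [Δ.index_conjReverse fun h => hz' (frontier_subset_closure h), Δ.index_eq_zero _ hz',
      map_zero]

end CauchyDomain

end Conjugate

/-! ### The complexification as a complex Banach algebra -/

namespace Complexification

variable {A : Type*} [NormedRing A] [NormedAlgebra ℝ A]

/-- The real part, as a continuous linear map. -/
def reCLM : Complexification A →L[ℝ] A :=
  LinearMap.mkContinuous
    { toFun := fun c => c.re
      map_add' := fun _ _ => rfl
      map_smul' := real_smul_re } ‖(1 : A)‖ norm_re_le

/-- The conjugation, as a continuous linear map. -/
def conjugationCLM : Complexification A →L[ℝ] Complexification A :=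
  conjugation.toLinearMap.mkContinuous (‖(1 : A)‖ + ‖(1 : A)‖) fun c => by
    refine (norm_le _).trans ?_
    rw [AlgHom.toLinearMap_apply, conjugation_re, conjugation_im, norm_neg, add_mul]
    exact add_le_add (norm_re_le c) (norm_im_le c)

/-- The norm defines the product topology: `norm_re_le` and `norm_im_le` make the components Cauchy,
and `norm_le` turns their limits into a limit in `A_ℂ`. -/
instance [CompleteSpace A] : CompleteSpace (Complexification A) := by
  refine Metric.complete_of_cauchySeq_tendsto fun u hu => ?_
  have hre : CauchySeq fun n => (u n).re := hu.map reCLM.uniformContinuous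
  have him : CauchySeq fun n => (u n).im := by
    let imLM : Complexification A →ₗ[ℝ] A :=
      { toFun := fun c => c.im, map_add' := fun _ _ => rfl, map_smul' := real_smul_im }
    exact hu.map (imLM.mkContinuous ‖(1 : A)‖ norm_im_le).uniformContinuous
  obtain ⟨a, ha⟩ := cauchySeq_tendsto_of_complete hre
  obtain ⟨b, hb⟩ := cauchySeq_tendsto_of_complete him
  refine ⟨⟨a, b⟩, tendsto_iff_norm_sub_tendsto_zero.2 ?_⟩
  refine squeeze_zero (fun _ => norm_nonneg _) (fun n => norm_le _) ?_
  simpa using (tendsto_iff_norm_sub_tendsto_zero.1 ha).add (tendsto_iff_norm_sub_tendsto_zero.1 hb)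

theorem conjugation_algebraMap (z : ℂ) :
    conjugation (algebraMap ℂ (Complexification A) z) = algebraMap ℂ _ (conj z) := by
  rw [Algebra.algebraMap_eq_smul_one, conjugation_smul, map_one, Algebra.algebraMap_eq_smul_one]

theorem eq_of_re_of_conjugation_eq {c : Complexification A} (h : conjugation c = c) :
    of c.re = c := by
  have him : -c.im = c.im := congrArg Complexification.im h
  ext
  · rfl
  · rw [neg_eq_iff_add_eq_zero, ← two_smul ℝ, smul_eq_zero] at him
    exact (him.resolve_left two_ne_zero).symm

theorem algebraMap_sub_of_mul (a : A) (z : ℂ) :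
    (algebraMap ℂ (Complexification A) z - of a) * (algebraMap ℂ _ (conj z) - of a) =
      of (a ^ 2 - (2 * z.re) • a + algebraMap ℝ A (‖z‖ ^ 2)) := by
  have h : ∀ w : ℂ, algebraMap ℂ (Complexification A) w = ⟨w.re • 1, w.im • 1⟩ := fun _ => rfl
  rw [h, h]
  ext
  · simp only [mul_re, sub_re, sub_im, of_re, of_im, Complex.conj_re, Complex.conj_im, sub_zero]
    simp only [mul_sub, sub_mul, smul_mul_assoc, mul_smul_comm, one_mul, mul_one, pow_two a,
      Complex.sq_norm, Complex.normSq_apply, Algebra.algebraMap_eq_smul_one]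
    module
  · simp only [mul_im, sub_re, sub_im, of_re, of_im, Complex.conj_re, Complex.conj_im, sub_zero]
    simp only [mul_sub, smul_mul_assoc, mul_smul_comm, one_mul, mul_one]
    module

/-- Multiplication by a real element acts on components separately, so the real part of an inverse
is an inverse in `A`. -/
theorem isUnit_of_iff {a : A} : IsUnit (of a) ↔ IsUnit a := by
  refine ⟨fun h => ?_, fun h => h.map of⟩
  obtain ⟨u, hu⟩ := h
  have h1 := congrArg Complexification.re u.mul_inv
  have h2 := congrArg Complexification.re u.inv_mul
  rw [hu] at h1 h2
  simp only [mul_re, of_re, of_im, zero_mul, mul_zero, sub_zero, one_re] at h1 h2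
  exact ⟨⟨a, _, h1, h2⟩, rfl⟩

/-- The quadratic element is the product of the commuting factors `z - a` and `z̄ - a`, so it is
invertible exactly when both are. Conjugation carries the one factor to the other, so one of them
suffices. -/
theorem spectrum_of (a : A) : spectrum ℂ (of a) = complexSpectrum a := by
  ext z
  rw [complexSpectrum, mem_ofPred_eq, ← isUnit_of_iff, ← algebraMap_sub_of_mul, spectrum.mem_iff,
    not_iff_not]
  have hcomm : Commute (algebraMap ℂ (Complexification A) z - of a)
      (algebraMap ℂ _ (conj z) - of a) := by
    refine Commute.sub_left (Algebra.commute_algebraMap_left _ _) ?_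
    exact (Algebra.commute_algebraMap_right _ _).sub_right (Commute.refl _)
  rw [hcomm.isUnit_mul_iff]
  refine ⟨fun h => ⟨h, ?_⟩, fun h => h.1⟩
  have := h.map (conjugation (A := A))
  rwa [map_sub, conjugation_algebraMap, conjugation_of] at this

theorem conjugation_resolvent {a : A} {z : ℂ} (hz : z ∉ spectrum ℂ (of a)) :
    conjugation (resolvent (of a) z) = resolvent (of a) (conj z) := by
  have h := congrArg (conjugation (A := A)) (sub_mul_resolvent hz)
  rw [map_mul, map_sub, conjugation_algebraMap, conjugation_of, map_one] at h
  have hz' : conj z ∉ spectrum ℂ (of a) := by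
    have := (spectrum.notMem_iff.1 hz).map (conjugation (A := A))
    rw [map_sub, conjugation_algebraMap, conjugation_of] at this
    exact spectrum.notMem_iff.2 this
  calc conjugation (resolvent (of a) z)
      = resolvent (of a) (conj z) * (algebraMap ℂ _ (conj z) - of a) *
          conjugation (resolvent (of a) z) := by rw [resolvent_mul_sub hz', one_mul]
    _ = resolvent (of a) (conj z) := by rw [mul_assoc, h, mul_one]

theorem conj_mem_complexSpectrum {a : A} {z : ℂ} (hz : z ∈ complexSpectrum a) :
    conj z ∈ complexSpectrum a := by
  simpa [complexSpectrum] using hz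

/-- The Riesz-Dunford integral of a stem function is real. -/
theorem conjugation_dunford [CompleteSpace A] {U : Set ℂ} (hU : IsOpen U)
    (hUc : ∀ z ∈ U, conj z ∈ U) {a : A} {Δ : CauchyDomain U} (ha : complexSpectrum a ⊆ Δ.carrier)
    {F : ℂ → Complexification A} (hF : DifferentiableOn ℂ F U)
    (hFc : ∀ z ∈ U, F (conj z) = conjugation (F z)) :
    conjugation (dunford Δ F (of a)) = dunford Δ F (of a) := by
  have ha₀ : spectrum ℂ (of a) ⊆ Δ.carrier := spectrum_of a ▸ ha
  have ha' : spectrum ℂ (of a) ⊆ (Δ.conjDomain hUc).carrier := fun z hz =>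
    ha (conj_mem_complexSpectrum (spectrum_of a ▸ hz))
  have hc : ContinuousOn (fun z => F z * resolvent (of a) z) (frontier Δ.carrier) :=
    ContinuousOn.fun_mul (hF.continuousOn.mono (frontier_subset_closure.trans Δ.closure_subset))
      (continuousOn_resolvent_frontier ha₀)
  -- The right side is moved to the mirrored domain, where it matches the conjugated integral curve
  -- by curve.
  refine Eq.trans ?_
    (dunford_eq ha₀ ha' hU Δ.closure_subset (Δ.conjDomain hUc).closure_subset hF).symm
  rw [dunford, dunford, conjugation_smul, conj_two_pi_I_inv, neg_smul, ← smul_neg]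
  congr 1
  rw [CauchyDomain.boundaryIntegral, CauchyDomain.boundaryIntegral, map_sum,
    ← Finset.sum_neg_distrib]
  refine Finset.sum_congr rfl fun j _ => ?_
  refine (contourIntegral_conjReverse (Δ.piecewiseC1 j) conjugationCLM conjugation_smul
    (hc.mono (Δ.image_curve_subset j))).symm.trans (contourIntegral_congr fun z hz => ?_)
  rw [image_conjReverse] at hz
  have hz' := Δ.image_curve_subset j hz
  change conjugation (F (conj z) * resolvent (of a) (conj z)) = _
  rw [map_mul, conjugation_resolvent (frontier_subset_compl_spectrum ha₀ hz'),
    ← hFc _ (Δ.closure_subset (frontier_subset_closure hz')), Complex.conj_conj]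

end Complexification

/-! ### The functional calculus -/

theorem dunford_sum {U : Set ℂ} {B : Type*} [NormedRing B] [NormedAlgebra ℂ B] [CompleteSpace B]
    {a : B} {Δ : CauchyDomain U} (ha : spectrum ℂ a ⊆ Δ.carrier) {ι : Type*} (s : Finset ι)
    {F : ι → ℂ → B} (hF : ∀ i, ContinuousOn (F i) (frontier Δ.carrier)) :
    dunford Δ (fun z => ∑ i ∈ s, F i z) a = ∑ i ∈ s, dunford Δ (F i) a := by
  classical
  induction s using Finset.induction_on with
  | empty => simpa using dunford_const ha (0 : B)
  | insert i s hi ih =>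
    simp only [Finset.sum_insert hi, ← ih]
    exact dunford_add ha (hF i) (continuousOn_finsetSum s fun i _ => hF i)

section Calculus

open Complexification

variable {A : Type*} [NormedRing A] [NormedAlgebra ℝ A] {U : Set ℂ}

theorem StemFunctions.conj_eq (hUc : ∀ z ∈ U, conj z ∈ U) (F : StemFunctions U A) {z : ℂ}
    (hz : z ∈ U) : zeroExtend F.1 (conj z) = conjugation (zeroExtend F.1 z) := by
  rw [zeroExtend_apply _ hz, zeroExtend_apply _ (hUc z hz)]
  exact F.2.2 ⟨z, hz⟩ ⟨conj z, hUc z hz⟩ rfl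

theorem StemFunctions.ofScalar_apply (f : ScalarStemFunctions U) (z : U) :
    (StemFunctions.ofScalar A f).1 z = algebraMap ℂ (Complexification A) (f.1 z) :=
  one_mul _

/-- Scalar stem functions as algebra-valued stem functions, as a linear map. -/
def StemFunctions.ofScalarₗ (U : Set ℂ) (A : Type*) [NormedRing A] [NormedAlgebra ℝ A] :
    ScalarStemFunctions U →ₗ[ℝ] StemFunctions U A where
  toFun := StemFunctions.ofScalar A
  map_add' f g := by
    refine Subtype.ext (funext fun z => ?_)
    change _ = (ofScalar A f).1 z + (ofScalar A g).1 z
    rw [ofScalar_apply, ofScalar_apply, ofScalar_apply, ← map_add]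
    rfl
  map_smul' r f := by
    refine Subtype.ext (funext fun z => ?_)
    change _ = r • (ofScalar A f).1 z
    rw [ofScalar_apply, ofScalar_apply, Algebra.algebraMap_eq_smul_one,
      Algebra.algebraMap_eq_smul_one, ← smul_assoc]
    rfl

theorem StemFunctions.mulScalar_ofScalar (f g : ScalarStemFunctions U) :
    StemFunctions.mulScalar (StemFunctions.ofScalar A f) g = StemFunctions.ofScalar A (f * g) := by
  refine Subtype.ext (funext fun z => ?_)
  change (ofScalar A f).1 z * algebraMap ℂ (Complexification A) (g.1 z) = _
  rw [ofScalar_apply, ofScalar_apply, ← map_mul]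
  rfl

theorem complexification_of_injective : Function.Injective (of : A →ₐ[ℝ] Complexification A) :=
  fun _ _ h => congrArg Complexification.re h

theorem isCompact_complexSpectrum [CompleteSpace A] (T : A) : IsCompact (complexSpectrum T) :=
  spectrum_of T ▸ spectrum.isCompact (of T)

theorem continuousOn_zeroExtend (Δ : CauchyDomain U) (F : StemFunctions U A) :
    ContinuousOn (zeroExtend F.1) (frontier Δ.carrier) :=
  F.2.1.continuousOn.mono (frontier_subset_closure.trans Δ.closure_subset)

variable [CompleteSpace A] {T : A} {Δ : CauchyDomain U}

/-- The linear map `F ↦ F(T)`. -/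
def stemCalculus (hT : complexSpectrum T ⊆ Δ.carrier) : StemFunctions U A →ₗ[ℝ] A where
  toFun F := (dunford Δ (zeroExtend F.1) (of T)).re
  map_add' F G := by
    have hsp : spectrum ℂ (of T) ⊆ Δ.carrier := spectrum_of T ▸ hT
    rw [← add_re, ← dunford_add hsp (continuousOn_zeroExtend Δ F) (continuousOn_zeroExtend Δ G)]
    refine congrArg _ (dunford_congr fun z hz => ?_)
    have hzU := Δ.closure_subset (frontier_subset_closure hz)
    simp only [zeroExtend_apply _ hzU]
    rfl
  map_smul' r F := by
    have hsp : spectrum ℂ (of T) ⊆ Δ.carrier := spectrum_of T ▸ hT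
    rw [RingHom.id_apply, ← real_smul_re, Algebra.smul_def r (dunford _ _ _),
      ← dunford_const_mul hsp _ (continuousOn_zeroExtend Δ F)]
    refine congrArg _ (dunford_congr fun z hz => ?_)
    have hzU := Δ.closure_subset (frontier_subset_closure hz)
    simp only [zeroExtend_apply _ hzU, ← Algebra.smul_def]
    rfl

/-- Taking the real part loses nothing, because the integral is fixed by the conjugation. -/
theorem of_stemCalculus (hU : IsOpen U) (hUc : ∀ z ∈ U, conj z ∈ U)
    (hT : complexSpectrum T ⊆ Δ.carrier) (F : StemFunctions U A) :
    of (stemCalculus hT F) = dunford Δ (zeroExtend F.1) (of T) :=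
  eq_of_re_of_conjugation_eq
    (conjugation_dunford hU hUc hT F.2.1 fun _ hz => StemFunctions.conj_eq hUc F hz)

theorem stemCalculus_mulScalar (hU : IsOpen U) (hUc : ∀ z ∈ U, conj z ∈ U)
    (hT : complexSpectrum T ⊆ Δ.carrier) (F : StemFunctions U A) (f : ScalarStemFunctions U) :
    stemCalculus hT (StemFunctions.mulScalar F f) =
      stemCalculus hT F * stemCalculus hT (StemFunctions.ofScalar A f) := by
  have hsp : spectrum ℂ (of T) ⊆ Δ.carrier := spectrum_of T ▸ hT
  refine complexification_of_injective ?_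
  rw [map_mul, of_stemCalculus hU hUc, of_stemCalculus hU hUc, of_stemCalculus hU hUc]
  have e₁ : dunford Δ (zeroExtend (StemFunctions.mulScalar F f).1) (of T) =
      dunford Δ (fun z => zeroExtend F.1 z * algebraMap ℂ _ (zeroExtend f.1 z)) (of T) := by
    refine dunford_congr fun z hz => ?_
    have hzU := Δ.closure_subset (frontier_subset_closure hz)
    simp only [zeroExtend_apply _ hzU]
    rfl
  have e₂ : dunford Δ (zeroExtend (StemFunctions.ofScalar A f).1) (of T) =
      dunford Δ (fun z => algebraMap ℂ _ (zeroExtend f.1 z)) (of T) := by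
    refine dunford_congr fun z hz => ?_
    have hzU := Δ.closure_subset (frontier_subset_closure hz)
    simp only [zeroExtend_apply _ hzU, StemFunctions.ofScalar_apply]
  rw [e₁, e₂, dunford_mul_algebraMap hU hsp F.2.1 f.2.1]

theorem stemCalculus_polynomial (hU : IsOpen U) (hUc : ∀ z ∈ U, conj z ∈ U)
    (hT : complexSpectrum T ⊆ Δ.carrier) (m : ℕ) (a : ℕ → A) :
    stemCalculus hT (StemFunctions.polynomial U m a) =
      ∑ n ∈ Finset.range (m + 1), a n * T ^ n := by
  have hsp : spectrum ℂ (of T) ⊆ Δ.carrier := spectrum_of T ▸ hT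
  have hpow : ∀ n : ℕ, ContinuousOn (fun z : ℂ => algebraMap ℂ (Complexification A) (z ^ n))
      (frontier Δ.carrier) := fun n => by
    simp only [Algebra.algebraMap_eq_smul_one]
    fun_prop
  refine complexification_of_injective ?_
  rw [of_stemCalculus hU hUc]
  -- The scalar powers are central, so the coefficients can be placed on the left and then pulled
  -- out as constants.
  have e : dunford Δ (zeroExtend (StemFunctions.polynomial U m a).1) (of T) =
      dunford Δ (fun z => ∑ n ∈ Finset.range (m + 1), of (a n) * algebraMap ℂ _ (z ^ n))
        (of T) := by
    refine dunford_congr fun z hz => ?_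
    have hzU := Δ.closure_subset (frontier_subset_closure hz)
    simp only [zeroExtend_apply _ hzU, ← Algebra.commutes, ← Algebra.smul_def]
    rfl
  rw [e, dunford_sum hsp _ fun n => ContinuousOn.fun_mul continuousOn_const (hpow n), map_sum]
  refine Finset.sum_congr rfl fun n _ => ?_
  rw [dunford_const_mul hsp _ (hpow n), dunford_pow hU hsp, map_mul, map_pow]

theorem stemCalculus_ofScalar_one (hU : IsOpen U) (hUc : ∀ z ∈ U, conj z ∈ U)
    (hT : complexSpectrum T ⊆ Δ.carrier) :
    stemCalculus hT (StemFunctions.ofScalar A (1 : ScalarStemFunctions U)) = 1 := by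
  have hsp : spectrum ℂ (of T) ⊆ Δ.carrier := spectrum_of T ▸ hT
  refine complexification_of_injective ?_
  rw [of_stemCalculus hU hUc, map_one, ← dunford_one hsp]
  refine dunford_congr fun z hz => ?_
  have hzU := Δ.closure_subset (frontier_subset_closure hz)
  rw [zeroExtend_apply _ hzU, StemFunctions.ofScalar_apply]
  exact map_one _

/-- The algebra morphism `f ↦ f(T)`. -/
def scalarStemCalculus (hU : IsOpen U) (hUc : ∀ z ∈ U, conj z ∈ U)
    (hT : complexSpectrum T ⊆ Δ.carrier) : ScalarStemFunctions U →ₐ[ℝ] A :=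
  AlgHom.ofLinearMap ((stemCalculus hT).comp (StemFunctions.ofScalarₗ U A))
    (stemCalculus_ofScalar_one hU hUc hT) fun f g => by
      change stemCalculus hT (StemFunctions.ofScalar A (f * g)) = _
      rw [← StemFunctions.mulScalar_ofScalar, stemCalculus_mulScalar hU hUc]
      rfl

/-- The Riesz-Dunford calculus of an element of a real Banach algebra. -/
theorem exists_stemCalculus (hU : IsOpen U) (hUc : ∀ z ∈ U, conj z ∈ U)
    (hT : complexSpectrum T ⊆ U) :
    (∃ Δ : CauchyDomain U, complexSpectrum T ⊆ Δ.carrier) ∧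
    ∃ (Φ : StemFunctions U A →ₗ[ℝ] A) (φ : ScalarStemFunctions U →ₐ[ℝ] A),
      (∀ Δ : CauchyDomain U, complexSpectrum T ⊆ Δ.carrier →
        ∀ F : StemFunctions U A, of (Φ F) = rieszDunford Δ F.1 T) ∧
      (∀ f : ScalarStemFunctions U, φ f = Φ (StemFunctions.ofScalar A f)) ∧
      (∀ (F : StemFunctions U A) (f : ScalarStemFunctions U),
        Φ (StemFunctions.mulScalar F f) = Φ F * φ f) ∧
      (∀ (m : ℕ) (a : ℕ → A),
        Φ (StemFunctions.polynomial U m a) = ∑ n ∈ Finset.range (m + 1), a n * T ^ n) := by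
  -- Both maps are defined with one fixed domain; independence of the domain gives the integral
  -- formula for every other.
  obtain ⟨Δ₀, hΔ₀, -⟩ := exists_cauchyDomain (isCompact_complexSpectrum T) hU hT
  refine ⟨⟨Δ₀, hΔ₀⟩, stemCalculus hΔ₀, scalarStemCalculus hU hUc hΔ₀, fun Δ hΔ F => ?_,
    fun f => rfl, stemCalculus_mulScalar hU hUc hΔ₀, stemCalculus_polynomial hU hUc hΔ₀⟩
  have hsp := spectrum_of T
  exact (of_stemCalculus hU hUc hΔ₀ F).trans (dunford_eq (hsp ▸ hΔ₀) (hsp ▸ hΔ) hU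
    Δ₀.closure_subset Δ.closure_subset F.2.1)

end Calculus

/-- For each `q` and `x` the condition equates two continuous functions of `T`, by continuity of
evaluation and of right multiplication by `q`. Closedness supplies the completeness required by the
calculus. -/
theorem isClosed_rightLinearOperators (V : Type*) [NormedAddCommGroup V] [NormedSpace ℝ V]
    [Module ℍ[ℝ]ᵐᵒᵖ V] [IsScalarTower ℝ ℍ[ℝ]ᵐᵒᵖ V] [ContinuousConstSMul ℍ[ℝ]ᵐᵒᵖ V] :
    IsClosed (rightLinearOperators V : Set (V →L[ℝ] V)) := by
  have : (rightLinearOperators V : Set (V →L[ℝ] V)) = ⋂ (q : ℍ[ℝ]) (x : V),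
      {T | T (MulOpposite.op q • x) = MulOpposite.op q • T x} := by
    ext T
    simp only [mem_iInter]
    rfl
  rw [this]
  refine isClosed_iInter fun q => isClosed_iInter fun x => isClosed_eq (by fun_prop) ?_
  exact Continuous.const_smul (by fun_prop) _

end

theorem theorem4p2 {V : Type*} [NormedAddCommGroup V] [NormedSpace ℝ V] [CompleteSpace V]
    [Module ℍ[ℝ] V] [IsScalarTower ℝ ℍ[ℝ] V] [ContinuousConstSMul ℍ[ℝ] V]
    [Module ℍ[ℝ]ᵐᵒᵖ V] [IsScalarTower ℝ ℍ[ℝ]ᵐᵒᵖ V] [ContinuousConstSMul ℍ[ℝ]ᵐᵒᵖ V]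
    (U : Set ℂ) (hU : IsOpen U) (hUconj : ∀ z ∈ U, conj z ∈ U)
    (T : rightLinearOperators V) (hT : complexSpectrum T ⊆ U) :
    (∃ Δ : CauchyDomain U, complexSpectrum T ⊆ Δ.carrier) ∧
    ∃ (Φ : StemFunctions U (rightLinearOperators V) →ₗ[ℝ] rightLinearOperators V)
      (φ : ScalarStemFunctions U →ₐ[ℝ] rightLinearOperators V),
      (∀ Δ : CauchyDomain U, complexSpectrum T ⊆ Δ.carrier →
        ∀ F : StemFunctions U (rightLinearOperators V),
          Complexification.of (Φ F) = rieszDunford Δ F.1 T) ∧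
      (∀ f : ScalarStemFunctions U,
        φ f = Φ (StemFunctions.ofScalar (rightLinearOperators V) f)) ∧
      (∀ (F : StemFunctions U (rightLinearOperators V)) (f : ScalarStemFunctions U),
        Φ (StemFunctions.mulScalar F f) = Φ F * φ f) ∧
      (∀ (m : ℕ) (a : ℕ → rightLinearOperators V),
        Φ (StemFunctions.polynomial U m a) = ∑ n ∈ Finset.range (m + 1), a n * T ^ n) := by

  have : CompleteSpace (rightLinearOperators V) :=
    (isClosed_rightLinearOperators V).completeSpace_coe
  exact exists_stemCalculus hU hUconj hT
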